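/- Let $d\ge 2$, let $\omega$ be the surface measure on the unit sphere $\mathbb S^{d-1}\subset\mathbb R^d$, and for $\mu\in\mathbb S^{d-1}$, $\kappa\ge 0$ let $f(x;\mu,\kappa)=c_d(\kappa)e^{\kappa\mu^Tx}$ be the von Mises–Fisher density with respect to $\omega$, where $c_d(\kappa)=\frac{\kappa^{d/2-1}}{(2\pi)^{d/2}I_{d/2-1}(\kappa)}$ for $\kappa>0$ ($I_r$ the modified Bessel function of the first kind) and $c_d(0)=1/\omega(\mathbb S^{d-1})$. For $p\ge 1$ let $\Gamma=\Pi\times(\mathbb S^{d-1}\times[0,\infty))^p$, where $\Pi$ is the set of $(\pi_1,\dots,\pi_p)$ with $\pi_k\ge 0$ and $\sum_k\pi_k=1$. A point $\gamma=((\pi_k)_k,(\mu_k,\kappa_k)_k)\in\Gamma$ has mixture density $f_\gamma=\sum_{k=1}^p\pi_kf(\cdot;\mu_k,\kappa_k)$. Let $\tilde\Gamma$ be the quotient topological space of $\Gamma$ obtained by identifying parameters whose densities are equal $\omega$-almost everywhere. Let $\gamma_0\in\Gamma$ be such that $f_{\gamma_0}$ is a genuine $p$-component mixture, i.e. it is not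 almost everywhere equal to a mixture of fewer than $p$ von Mises–Fisher densities. Let $X_1,X_2,\dots$ be i.i.d. with density $f_{\gamma_0}$. Put $M=\max_{x}f_{\gamma_0}(x)$ and $A_2=2^{d-1}\,\frac{2\pi^{(d-1)/2}}{\Gamma((d-1)/2)}$ (here $\Gamma(\cdot)$ is the gamma function). Let $p_n$ be penalty functions of $\boldsymbol\kappa=(\kappa_1,\dots,\kappa_p)\in[0,\infty)^p$ such that, for some functions $\tilde p_n:[0,\infty)\to\mathbb R$: C1. $p_n(\boldsymbol\kappa)=\sum_{l=1}^p\tilde p_n(\kappa_l)$; C2. $\sup_{\kappa>0}\max\{0,\tilde p_n(\kappa)\}=o(n)$, and $\tilde p_n(\kappa)=o(n)$ for each fixed $\kappa\ge 0$; C3. for all sufficiently large $n$, $\tilde p_n(\kappa)\le-3(\log n)^2\log\kappa$ for every $\kappa>1$ with $\frac1{(\log\kappa)^{2d-2}}\le\frac{\log n}{MnA_2}$. Let $pl_n(\gamma)=\sum_{i=1}^n\log f_\gamma(X_i)+p_n(\boldsymbol\kappa)$. If, almost surely, $\hat\gamma_n$ is a maximizer of $pl_n$ over $\Gamma$ for all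 sufficiently large $n$, then almost surely $\hat\gamma_n\to\gamma_0$ in $\tilde\Gamma$ as $n\to\infty$. -/

import Mathlib

open MeasureTheory ProbabilityTheory Filter Topology Asymptotics
open scoped NNReal ENNReal

noncomputable section

namespace VMF

/-- The unit sphere of `ℝ^d` with the Euclidean norm. -/
abbrev Sphere (d : ℕ) : Type := Metric.sphere (0 : EuclideanSpace ℝ (Fin d)) 1

/-- The standard (unnormalized) surface measure on the unit sphere of `ℝ^d`. -/
def surface (d : ℕ) : Measure (Sphere d) :=
  (volume : Measure (EuclideanSpace ℝ (Fin d))).toSphere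

/-- The modified Bessel function of the first kind of order `r`, by its power series
(for `z > 0`). -/
def besselI (r z : ℝ) : ℝ :=
  ∑' m : ℕ, (z / 2) ^ (2 * (m : ℝ) + r) / ((m.factorial : ℝ) * Real.Gamma ((m : ℝ) + r + 1))

/-- The normalizing constant of the von Mises-Fisher density. At concentration `0`, where the
Bessel formula reads `0 / 0` for `d > 2`, it is the constant of the uniform distribution. -/
def normConst (d : ℕ) (κ : ℝ≥0) : ℝ :=
  if κ = 0 then ((surface d).real Set.univ)⁻¹
  else (κ : ℝ) ^ ((d : ℝ) / 2 - 1) /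
    ((2 * Real.pi) ^ ((d : ℝ) / 2) * besselI ((d : ℝ) / 2 - 1) (κ : ℝ))

/-- Parameters `(μ, κ)` of one component: a mean direction and a concentration `κ ≥ 0`. -/
abbrev Component (d : ℕ) : Type := Sphere d × ℝ≥0

/-- The von Mises-Fisher density with respect to the surface measure. -/
def density {d : ℕ} (θ : Component d) (x : Sphere d) : ℝ :=
  normConst d θ.2 *
    Real.exp ((θ.2 : ℝ) * inner ℝ (θ.1 : EuclideanSpace ℝ (Fin d)) (x : EuclideanSpace ℝ (Fin d)))

/-- The parameter space of `p`-component mixtures: mixing proportions (nonnegative, with sum `1`)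
and the parameters of the `p` components, with the product topology. -/
abbrev Param (d p : ℕ) : Type := stdSimplex ℝ (Fin p) × (Fin p → Component d)

/-- The mixture density. -/
def mixDensity {d p : ℕ} (γ : Param d p) (x : Sphere d) : ℝ :=
  ∑ k, (γ.1 : Fin p → ℝ) k * density (γ.2 k) x

/-- The distribution on the sphere with density `mixDensity γ`. -/
def mixMeasure {d p : ℕ} (γ : Param d p) : Measure (Sphere d) :=
  (surface d).withDensity fun x => ENNReal.ofReal (mixDensity γ x)

/-- Two parameters are identified when their mixture densities agree almost everywhere. -/
instance paramSetoid (d p : ℕ) : Setoid (Param d p) where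
  r γ γ' := mixDensity γ =ᵐ[surface d] mixDensity γ'
  iseqv := ⟨fun _ => ae_eq_refl _, fun h => h.symm, fun h h' => h.trans h'⟩

/-- The quotient space of the parameter space, with the quotient topology. -/
abbrev QuotParam (d p : ℕ) : Type := Quotient (paramSetoid d p)

/-- The mixture has exactly `p` components: its density is not that of a mixture of fewer
than `p` von Mises-Fisher distributions. -/
def HasExactOrder {d p : ℕ} (γ : Param d p) : Prop :=
  ∀ q : ℕ, q < p → ∀ γ' : Param d q, ¬ (mixDensity γ =ᵐ[surface d] mixDensity γ')

/-- The log-likelihood of the first `n` observations of the sequence `x`. -/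
def logLik {d p : ℕ} (x : ℕ → Sphere d) (n : ℕ) (γ : Param d p) : ℝ :=
  ∑ i ∈ Finset.range n, Real.log (mixDensity γ (x i))

/-- The penalized log-likelihood, for the penalty functions `pen n` of `(κ_1, …, κ_p)`. -/
def penLogLik {d p : ℕ} (pen : ℕ → (Fin p → ℝ≥0) → ℝ) (x : ℕ → Sphere d) (n : ℕ)
    (γ : Param d p) : ℝ :=
  logLik x n γ + pen n fun l => (γ.2 l).2

/-- The maximum of the mixture density over the (compact) sphere. -/
def maxDensity {d p : ℕ} (γ : Param d p) : ℝ := ⨆ x : Sphere d, mixDensity γ x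

/-- The constant `A₂ = 2^{d-1} · 2 π^{(d-1)/2} / Γ((d-1)/2)` (for `d ≥ 2`). -/
def constA (d : ℕ) : ℝ :=
  2 ^ (d - 1) * (2 * Real.pi ^ (((d : ℝ) - 1) / 2) / Real.Gamma (((d : ℝ) - 1) / 2))

/-- C1: the penalty is additive in the concentrations. -/
def CondC1 {p : ℕ} (pen : ℕ → (Fin p → ℝ≥0) → ℝ) (pt : ℕ → ℝ≥0 → ℝ) : Prop :=
  ∀ n κ, pen n κ = ∑ l, pt n (κ l)

/-- C2: the supremum over `κ > 0` of the positive part of the penalty is (finite for large `n`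
and) `o(n)`, and the penalty at each fixed `κ ≥ 0` is `o(n)`. -/
def CondC2 (pt : ℕ → ℝ≥0 → ℝ) : Prop :=
  ((∀ᶠ n in atTop, BddAbove (Set.range fun κ : {κ : ℝ≥0 // 0 < κ} => max 0 (pt n κ))) ∧
    (fun n : ℕ => ⨆ κ : {κ : ℝ≥0 // 0 < κ}, max 0 (pt n κ)) =o[atTop] fun n : ℕ => (n : ℝ)) ∧
  ∀ κ : ℝ≥0, (fun n : ℕ => pt n κ) =o[atTop] fun n : ℕ => (n : ℝ)

/-- C3: for all large `n`, the penalty is at most `-3 (log n)² log κ` for every `κ > 1` with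
`1 / (log κ)^{2d-2} ≤ log n / (M n A₂)`. -/
def CondC3 (d : ℕ) (M : ℝ) (pt : ℕ → ℝ≥0 → ℝ) : Prop :=
  ∀ᶠ n : ℕ in atTop, ∀ κ : ℝ≥0, 1 < κ →
    1 / Real.log κ ^ (2 * d - 2) ≤ Real.log n / (M * n * constA d) →
    pt n κ ≤ -3 * Real.log n ^ 2 * Real.log κ

end VMF

end

/-!
Wald's consistency argument on a compactified parameter space. Along an ultrafilter the weights
converge, and every component either converges or has concentration tending to infinity. Up to
`o(n)`, a component of the second kind contributes nothing to the penalized log-likelihood: such a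
component is negligible away from a small cap, a cap of radius `r` contains at most `1 + A n r ^ s`
observations, and the penalty pays for the single observation on which the density may be as large
as a power of the concentration. The remaining incomplete mixture therefore maximizes the expected
log-likelihood, so that by the equality case of Gibbs' inequality it is the true density; as the
latter is not a mixture of fewer components, no component was lost.

The uniform bound on the number of observations in small caps comes from a moment bound for
`∑ i < j, dist (X i) (X j) ^ (-s)`, which controls the number of pairs of observations in a cap.
-/

namespace VMF

section PolarCoordinates

open Module

variable {E : Type*} [NormedAddCommGroup E] [NormedSpace ℝ E] [FiniteDimensional ℝ E]
  [MeasurableSpace E] [BorelSpace E]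

lemma integral_volumeIoiPow (n : ℕ) (h : ℝ → ℝ) :
    ∫ r : Set.Ioi (0 : ℝ), h r ∂(Measure.volumeIoiPow n) = ∫ r in Set.Ioi 0, r ^ n * h r := by
  simp only [Measure.volumeIoiPow, ENNReal.ofReal]
  rw [integral_withDensity_eq_integral_smul (by fun_prop),
    integral_subtype_comap measurableSet_Ioi fun r : ℝ ↦ Real.toNNReal (r ^ n) • h r]
  refine setIntegral_congr_fun measurableSet_Ioi fun r hr ↦ ?_
  simp only [NNReal.smul_def, Real.coe_toNNReal _ (pow_nonneg (le_of_lt hr) n), smul_eq_mul]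

lemma integral_homogeneous_mul_radial [Nontrivial E] (μ : Measure E) [μ.IsAddHaarMeasure]
    {f : E → ℝ} {n : ℕ} (hf : ∀ (r : ℝ) y, f (r • y) = r ^ n * f y) (h : ℝ → ℝ) :
    ∫ y, f y * h ‖y‖ ∂μ = (∫ x : Metric.sphere (0 : E) 1, f x ∂μ.toSphere) *
      ∫ r in Set.Ioi 0, r ^ (finrank ℝ E - 1) * (r ^ n * h r) := by
  calc
    ∫ y, f y * h ‖y‖ ∂μ = ∫ y : ({0}ᶜ : Set E), f y * h ‖(y : E)‖ ∂(μ.comap (↑)) := by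
      rw [integral_subtype_comap (measurableSet_singleton _).compl fun y ↦ f y * h ‖y‖,
        restrict_compl_singleton]
    _ = ∫ q : Metric.sphere (0 : E) 1 × Set.Ioi (0 : ℝ), f q.1 * ((q.2 : ℝ) ^ n * h q.2)
          ∂μ.toSphere.prod (.volumeIoiPow (finrank ℝ E - 1)) := by
      rw [← μ.measurePreserving_homeomorphUnitSphereProd.integral_comp
        (Homeomorph.measurableEmbedding _)]
      refine integral_congr_ae (.of_forall fun y ↦ ?_)
      have hy : ‖(y : E)‖ ≠ 0 := norm_ne_zero_iff.2 y.2
      simp only [homeomorphUnitSphereProd_apply_fst_coe, homeomorphUnitSphereProd_apply_snd_coe,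
        hf, inv_pow]
      field_simp
    _ = _ := by
      rw [integral_prod_mul (fun x : Metric.sphere (0 : E) 1 ↦ f x)
        (fun r : Set.Ioi (0 : ℝ) ↦ (r : ℝ) ^ n * h r), integral_volumeIoiPow _ fun r ↦ r ^ n * h r]

end PolarCoordinates

section GaussianMoments

open Module

lemma integral_pow_two_mul_gaussianReal (m : ℕ) :
    ∫ x, x ^ (2 * m) ∂(gaussianReal 0 1) = ((2 * m).factorial : ℝ) / (2 ^ m * m.factorial) := by
  have hdensity (x : ℝ) : gaussianPDFReal 0 1 x • x ^ (2 * m) = (√(2 * Real.pi))⁻¹ *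
      (|x| ^ ((2 * m : ℕ) : ℝ) * Real.exp (-(1 / 2) * |x| ^ (2 : ℝ))) := by
    simp only [gaussianPDFReal_def, smul_eq_mul, Real.rpow_natCast, Real.rpow_two, sq_abs,
      Even.pow_abs (even_two_mul m)]
    norm_num
    ring_nf
  have hexponent : (((2 * m : ℕ) : ℝ) + 1) / 2 = m + 1 / 2 := by push_cast; ring
  have hscale : (1 / 2 : ℝ) ^ (-(((2 * m : ℕ) : ℝ) + 1) / 2) = 2 ^ m * √2 := by
    rw [neg_div, hexponent, one_div, Real.inv_rpow (by norm_num), Real.rpow_neg (by norm_num),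
      inv_inv, Real.rpow_add (by norm_num), Real.rpow_natCast, Real.sqrt_eq_rpow, one_div]
  have hfactorial : (2 * m).factorial = 2 ^ m * m.factorial * (2 * m - 1).doubleFactorial := by
    rcases m with _ | k
    · simp
    · rw [← Nat.doubleFactorial_two_mul]
      exact Nat.factorial_eq_mul_doubleFactorial (2 * k + 1)
  rw [integral_gaussianReal_eq_integral_smul one_ne_zero, integral_congr_ae (.of_forall hdensity),
    integral_const_mul,
    integral_comp_abs (f := fun y : ℝ ↦ y ^ ((2 * m : ℕ) : ℝ) * Real.exp (-(1 / 2) * y ^ (2 : ℝ))),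
    integral_rpow_mul_exp_neg_mul_rpow two_pos (by linarith [(2 * m).cast_nonneg (α := ℝ)])
      (by norm_num),
    hscale, hexponent, Real.Gamma_nat_add_half, Real.sqrt_mul zero_le_two, hfactorial]
  push_cast
  field_simp

lemma integral_pow_gaussianReal_of_odd {n : ℕ} (hn : Odd n) :
    ∫ x, x ^ n ∂(gaussianReal 0 1) = 0 := by
  have hsymm : ∫ x, x ^ n ∂(gaussianReal 0 1) = ∫ x, (-x) ^ n ∂(gaussianReal 0 1) := by
    rw [← integral_map (φ := Neg.neg) (f := fun x : ℝ ↦ x ^ n) (by fun_prop) (by fun_prop)]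
    simp [gaussianReal_map_neg]
  simp only [hn.neg_pow, integral_neg] at hsymm
  linarith

variable {E : Type*} [NormedAddCommGroup E] [InnerProductSpace ℝ E] [FiniteDimensional ℝ E]
  [MeasurableSpace E] [BorelSpace E]

/-- The unnormalized Gaussian measure with Lebesgue density `exp (-‖y‖² / 2)`. It carries the
moments of a linear form from the line to the unit sphere. -/
noncomputable def gaussianWeight (E : Type*) [NormedAddCommGroup E] [InnerProductSpace ℝ E]
    [FiniteDimensional ℝ E] [MeasurableSpace E] [BorelSpace E] : Measure E :=
  volume.withDensity fun y ↦ ENNReal.ofReal (Real.exp (-‖y‖ ^ 2 / 2))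

lemma integral_gaussianWeight (f : E → ℝ) :
    ∫ y, f y ∂(gaussianWeight E) = ∫ y, f y * Real.exp (-‖y‖ ^ 2 / 2) := by
  rw [gaussianWeight, integral_withDensity_eq_integral_toReal_smul (by fun_prop) (by simp)]
  simp only [ENNReal.toReal_ofReal (Real.exp_nonneg _), smul_eq_mul, mul_comm]

lemma mgf_inner_gaussianWeight {u : E} (hu : ‖u‖ = 1) (t : ℝ) :
    mgf (inner ℝ u) (gaussianWeight E) t =
      (2 * Real.pi) ^ ((finrank ℝ E : ℝ) / 2) * Real.exp (t ^ 2 / 2) := by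
  have hexp (y : E) : ((Real.exp (t * inner ℝ u y) * Real.exp (-‖y‖ ^ 2 / 2) : ℝ) : ℂ) =
      Complex.exp (-(1 / 2) * (‖y‖ : ℂ) ^ 2 + t * (inner ℝ u y : ℝ)) := by
    rw [← Real.exp_add]
    push_cast
    ring_nf
  rw [mgf, integral_gaussianWeight, ← Complex.ofReal_inj, ← integral_complex_ofReal]
  simp_rw [hexp]
  rw [GaussianFourier.integral_cexp_neg_mul_sq_norm_add (by norm_num), hu]
  push_cast
  rw [Complex.ofReal_cpow (by positivity)]
  push_cast
  ring_nf

lemma integrableExpSet_inner_gaussianWeight {u : E} (hu : ‖u‖ = 1) :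
    integrableExpSet (inner ℝ u) (gaussianWeight E) = Set.univ := by
  refine Set.eq_univ_of_forall fun t ↦ by_contra fun hnot ↦ ?_
  have hmgf := mgf_inner_gaussianWeight hu t
  rw [mgf, integral_undef hnot] at hmgf
  exact hmgf.not_lt (by positivity)

lemma integral_inner_pow_gaussianWeight {u : E} (hu : ‖u‖ = 1) (n : ℕ) :
    ∫ y, inner ℝ u y ^ n ∂(gaussianWeight E) =
      (2 * Real.pi) ^ ((finrank ℝ E : ℝ) / 2) * ∫ x, x ^ n ∂(gaussianReal 0 1) := by
  have hmgf : mgf (inner ℝ u) (gaussianWeight E) =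
      fun t ↦ (2 * Real.pi) ^ ((finrank ℝ E : ℝ) / 2) * mgf id (gaussianReal 0 1) t := by
    ext t
    simp [mgf_inner_gaussianWeight hu t, mgf_id_gaussianReal]
  have hderiv := iteratedDeriv_mgf_zero (X := inner ℝ u) (μ := gaussianWeight E)
    (by simp [integrableExpSet_inner_gaussianWeight hu]) n
  rw [hmgf, iteratedDeriv_const_mul_field, iteratedDeriv_mgf_zero (by simp) n] at hderiv
  simpa using hderiv.symm

end GaussianMoments

section Bessel

open Module

lemma integrable_of_continuous {S : Type*} [TopologicalSpace S] [CompactSpace S]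
    [MeasurableSpace S] [OpensMeasurableSpace S] (ν : Measure S) [IsFiniteMeasure ν] {f : S → ℝ}
    (hf : Continuous f) : Integrable f ν :=
  hf.integrable_of_hasCompactSupport (HasCompactSupport.of_compactSpace f)

lemma hasSum_integral_exp_mul {S : Type*} [TopologicalSpace S] [CompactSpace S]
    [MeasurableSpace S] [OpensMeasurableSpace S] (ν : Measure S) [IsFiniteMeasure ν] {f : S → ℝ}
    (hf : Continuous f) (κ : ℝ) :
    HasSum (fun n : ℕ ↦ κ ^ n / n.factorial * ∫ x, f x ^ n ∂ν)
      (∫ x, Real.exp (κ * f x) ∂ν) := by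
  obtain ⟨B, hB⟩ := (isCompact_range hf).isBounded.exists_norm_le
  have hterm (n : ℕ) (x : S) : ‖(κ * f x) ^ n / n.factorial‖ ≤ (|κ| * B) ^ n / n.factorial := by
    rw [norm_div, norm_pow, norm_mul, Real.norm_natCast, Real.norm_eq_abs κ]
    gcongr
    exact hB _ ⟨x, rfl⟩
  have hexp (x : S) : HasSum (fun n : ℕ ↦ (κ * f x) ^ n / n.factorial) (Real.exp (κ * f x)) := by
    rw [Real.exp_eq_exp_ℝ]
    exact NormedSpace.expSeries_div_hasSum_exp (κ * f x)
  have hmeas (n : ℕ) : AEStronglyMeasurable (fun x ↦ (κ * f x) ^ n / n.factorial) ν :=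
    ((continuous_const.mul hf).pow n |>.div_const _).aestronglyMeasurable
  have hsum := hasSum_integral_of_dominated_convergence (fun n _ ↦ (|κ| * B) ^ n / n.factorial)
    hmeas (fun n ↦ .of_forall (hterm n))
    (.of_forall fun _ ↦ Real.summable_pow_div_factorial (|κ| * B))
    (integrable_const _) (.of_forall hexp)
  simpa only [mul_pow, mul_div_right_comm, integral_const_mul] using hsum

variable {E : Type*} [NormedAddCommGroup E] [InnerProductSpace ℝ E] [FiniteDimensional ℝ E]
  [MeasurableSpace E] [BorelSpace E]

local notation "dim" => (finrank ℝ E : ℝ)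

lemma integral_sphere_inner_pow_mul_Gamma [Nontrivial E] {u : E} (hu : ‖u‖ = 1) (n : ℕ) :
    (∫ x : Metric.sphere (0 : E) 1, inner ℝ u (x : E) ^ n ∂(volume : Measure E).toSphere) *
        (2 ^ ((n + dim) / 2 - 1) * Real.Gamma ((n + dim) / 2)) =
      (2 * Real.pi) ^ (dim / 2) * ∫ x, x ^ n ∂(gaussianReal 0 1) := by
  have hdim : 1 ≤ finrank ℝ E := Module.finrank_pos
  have hradial : ∫ r in Set.Ioi (0 : ℝ), r ^ (finrank ℝ E - 1) * (r ^ n * Real.exp (-r ^ 2 / 2)) =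
      2 ^ ((n + dim) / 2 - 1) * Real.Gamma ((n + dim) / 2) := by
    have hexp : ((finrank ℝ E - 1 + n : ℕ) : ℝ) = n + dim - 1 := by
      push_cast [Nat.cast_sub hdim]; ring
    calc
      _ = ∫ r in Set.Ioi (0 : ℝ), r ^ (n + dim - 1) * Real.exp (-(1 / 2) * r ^ (2 : ℝ)) := by
        refine setIntegral_congr_fun measurableSet_Ioi fun r _ ↦ ?_
        simp only [← hexp, Real.rpow_natCast, Real.rpow_two, ← mul_assoc, ← pow_add]
        ring_nf
      _ = _ := by
        rw [integral_rpow_mul_exp_neg_mul_rpow two_pos (by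
          rw [← hexp]; exact neg_one_lt_zero.trans_le (Nat.cast_nonneg _)) (by norm_num),
          Real.rpow_sub_one two_ne_zero, one_div, Real.inv_rpow zero_le_two,
          ← Real.rpow_neg zero_le_two]
        ring_nf
  rw [← integral_inner_pow_gaussianWeight hu, integral_gaussianWeight,
    integral_homogeneous_mul_radial volume (f := fun y ↦ inner ℝ u y ^ n) (n := n)
      (fun r y ↦ by rw [real_inner_smul_right, mul_pow]) (fun r ↦ Real.exp (-r ^ 2 / 2)), hradial]

lemma integral_sphere_inner_pow_of_odd [Nontrivial E] {u : E} (hu : ‖u‖ = 1) {n : ℕ}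
    (hn : Odd n) :
    ∫ x : Metric.sphere (0 : E) 1, inner ℝ u (x : E) ^ n ∂(volume : Measure E).toSphere = 0 := by
  have hdim : (0 : ℝ) < dim := Nat.cast_pos.2 finrank_pos
  have hmoment := integral_sphere_inner_pow_mul_Gamma hu n
  rw [integral_pow_gaussianReal_of_odd hn, mul_zero] at hmoment
  have hGamma := Real.Gamma_pos_of_pos (show 0 < (n + dim) / 2 by positivity)
  exact (mul_eq_zero.1 hmoment).resolve_right (mul_pos (by positivity) hGamma).ne'

lemma integral_sphere_inner_pow_two_mul [Nontrivial E] {u : E} (hu : ‖u‖ = 1) (m : ℕ) :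
    ∫ x : Metric.sphere (0 : E) 1, inner ℝ u (x : E) ^ (2 * m) ∂(volume : Measure E).toSphere =
      (2 * Real.pi) ^ (dim / 2) * (2 * m).factorial /
        (2 ^ (2 * m + (dim / 2 - 1)) * m.factorial * Real.Gamma (m + dim / 2)) := by
  have hdim : (0 : ℝ) < dim := Nat.cast_pos.2 finrank_pos
  have hmoment := integral_sphere_inner_pow_mul_Gamma hu (2 * m)
  have hhalf : (((2 * m : ℕ) : ℝ) + dim) / 2 = m + dim / 2 := by push_cast; ring
  have hGamma := Real.Gamma_pos_of_pos (show 0 < m + dim / 2 by positivity)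
  have hpow : (2 : ℝ) ^ (2 * m + (dim / 2 - 1)) = 2 ^ m * 2 ^ (m + dim / 2 - 1) := by
    rw [← Real.rpow_natCast, ← Real.rpow_add two_pos]
    ring_nf
  rw [hhalf, integral_pow_two_mul_gaussianReal, ← eq_div_iff (by positivity)] at hmoment
  rw [hmoment, hpow]
  field_simp

lemma integral_exp_inner_eq_besselI [Nontrivial E] {u : E} (hu : ‖u‖ = 1) {κ : ℝ} (hκ : 0 < κ) :
    κ ^ (dim / 2 - 1) *
        ∫ x : Metric.sphere (0 : E) 1, Real.exp (κ * inner ℝ u (x : E))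
          ∂(volume : Measure E).toSphere =
      (2 * Real.pi) ^ (dim / 2) * besselI (dim / 2 - 1) κ := by
  have hsum := hasSum_integral_exp_mul (volume : Measure E).toSphere
    (f := fun x : Metric.sphere (0 : E) 1 ↦ inner ℝ u (x : E)) (by fun_prop) κ
  have hinj : Function.Injective fun m : ℕ ↦ 2 * m := mul_right_injective₀ two_ne_zero
  rw [← hinj.hasSum_iff fun n hn ↦ by
    rw [integral_sphere_inner_pow_of_odd hu (Nat.not_even_iff_odd.1 fun ⟨m, hm⟩ ↦
      hn ⟨m, by rw [hm, ← two_mul]⟩), mul_zero]] at hsum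
  rw [← hsum.tsum_eq, besselI, ← tsum_mul_left, ← tsum_mul_left]
  refine tsum_congr fun m ↦ ?_
  have hindex : (m : ℝ) + (dim / 2 - 1) + 1 = m + dim / 2 := by ring
  simp only [Function.comp_apply]
  rw [integral_sphere_inner_pow_two_mul hu, hindex, Real.div_rpow hκ.le zero_le_two,
    Real.rpow_add hκ (2 * m), ← Nat.cast_ofNat, ← Nat.cast_mul, Real.rpow_natCast]
  field_simp

end Bessel

section SphericalCaps

open Module
open scoped Pointwise

variable {E : Type*} [NormedAddCommGroup E] [NormedSpace ℝ E]

/-- The open cone of height one over a subset of the unit sphere, with its apex at the origin. The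
spherical measure of the subset is the dimension times the volume of this cone. -/
def openCone (s : Set (Metric.sphere (0 : E) 1)) : Set E :=
  Set.Ioo (0 : ℝ) 1 • (Subtype.val '' s)

lemma openCone_closedBall_subset (x : Metric.sphere (0 : E) 1) (r : ℝ) :
    openCone (Metric.closedBall x r) ⊆
      ((1 - r) • openCone (Metric.closedBall x r)) ∪ Metric.closedBall (x : E) (2 * r) := by
  rintro _ ⟨t, ⟨ht0, ht1⟩, _, ⟨y, hy, rfl⟩, rfl⟩
  rcases lt_or_ge t (1 - r) with ht | ht
  · have hr : 0 < 1 - r := ht0.trans ht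
    refine .inl ⟨(t / (1 - r)) • (y : E), ⟨_, ⟨div_pos ht0 hr, (div_lt_one hr).2 ht⟩, _,
      ⟨y, hy, rfl⟩, rfl⟩, ?_⟩
    simp only [smul_smul, mul_div_cancel₀ t hr.ne']
  · refine .inr ?_
    have hradial : dist (t • (y : E)) y = 1 - t := by
      have hsub : (y : E) - t • (y : E) = (1 - t) • (y : E) := by rw [sub_smul, one_smul]
      rw [dist_comm, dist_eq_norm, hsub, norm_smul, norm_eq_of_mem_sphere, mul_one,
        Real.norm_of_nonneg (by linarith)]
    have htangential : dist (y : E) x ≤ r := hy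
    exact (dist_triangle _ (y : E) _).trans (by linarith)

variable [FiniteDimensional ℝ E] [MeasurableSpace E] [BorelSpace E]

lemma toSphere_real_closedBall_le [Nontrivial E] (μ : Measure E) [μ.IsAddHaarMeasure]
    (x : Metric.sphere (0 : E) 1) {r : ℝ} (hr0 : 0 < r) (hr1 : r ≤ 1) :
    μ.toSphere.real (Metric.closedBall x r) ≤
      finrank ℝ E * 2 ^ finrank ℝ E * μ.real (Metric.ball 0 1) * r ^ (finrank ℝ E - 1) := by
  set n := finrank ℝ E
  set C := openCone (Metric.closedBall x r)
  have hn : n ≠ 0 := finrank_pos.ne'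
  have hbounded : C ⊆ Metric.ball 0 1 := by
    rintro _ ⟨t, ⟨ht0, ht1⟩, _, ⟨y, -, rfl⟩, rfl⟩
    simpa [norm_smul, abs_of_pos ht0] using ht1
  have hfinite : μ C ≠ ∞ := measure_ne_top_of_subset hbounded measure_ball_lt_top.ne
  have hscaled : μ.real ((1 - r) • C) = (1 - r) ^ n * μ.real C := by
    rw [measureReal_def, Measure.addHaar_smul_of_nonneg μ (by linarith), ENNReal.toReal_mul,
      ENNReal.toReal_ofReal (pow_nonneg (by linarith) _), measureReal_def]
  have hball : μ.real (Metric.closedBall (x : E) (2 * r)) =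
      (2 * r) ^ n * μ.real (Metric.ball 0 1) := by
    rw [measureReal_def, Measure.addHaar_closedBall μ _ (by positivity), ENNReal.toReal_mul,
      ENNReal.toReal_ofReal (by positivity), measureReal_def]
  have hsplit : μ.real C ≤ (1 - r) ^ n * μ.real C + (2 * r) ^ n * μ.real (Metric.ball 0 1) := by
    rw [← hscaled, ← hball]
    exact (measureReal_mono (openCone_closedBall_subset x r) (measure_union_ne_top
      (by rw [Measure.addHaar_smul_of_nonneg μ (by linarith)]; finiteness)
      measure_closedBall_lt_top.ne)).trans (measureReal_union_le _ _)
  have hshrink : (1 - r) ^ n * μ.real C ≤ (1 - r) * μ.real C :=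
    mul_le_mul_of_nonneg_right (pow_le_of_le_one (by linarith) (by linarith) hn)
      measureReal_nonneg
  have hC : μ.real C ≤ 2 ^ n * μ.real (Metric.ball 0 1) * r ^ (n - 1) := by
    refine le_of_mul_le_mul_left ?_ hr0
    rw [mul_pow, ← mul_pow_sub_one hn r] at hsplit
    linarith
  calc μ.toSphere.real (Metric.closedBall x r) = n * μ.real C := by
        rw [measureReal_def, μ.toSphere_apply' measurableSet_closedBall, ENNReal.toReal_mul,
          ENNReal.toReal_natCast]
        rfl
    _ ≤ n * (2 ^ n * μ.real (Metric.ball 0 1) * r ^ (n - 1)) := by gcongr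
    _ = _ := by ring

end SphericalCaps

/-- Upper Ahlfors regularity with exponent `β`: small balls have mass at most `C * r ^ β`. This is
all that the argument uses of the distribution of the observations near a point. -/
def UpperRegular {S : Type*} [PseudoMetricSpace S] [MeasurableSpace S] (ν : Measure S)
    (C β : ℝ) : Prop :=
  ∀ x : S, ∀ r : ℝ, 0 < r → r ≤ 1 → ν.real (Metric.closedBall x r) ≤ C * r ^ β

section Density

variable {d p : ℕ}

instance : IsFiniteMeasure (surface d) := inferInstanceAs (IsFiniteMeasure volume.toSphere)

instance [NeZero d] : NeZero (surface d) := ⟨Measure.toSphere_ne_zero _⟩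

instance [NeZero d] : Nonempty (Sphere d) := (NormedSpace.sphere_nonempty.2 zero_le_one).to_subtype

lemma inner_sphere_eq_one_sub_dist_sq (μ x : Sphere d) :
    inner ℝ (μ : EuclideanSpace ℝ (Fin d)) x = 1 - dist x μ ^ 2 / 2 := by
  rw [Subtype.dist_eq, dist_eq_norm, norm_sub_sq_real, real_inner_comm, norm_eq_of_mem_sphere,
    norm_eq_of_mem_sphere]
  ring

lemma integral_exp_inner_pos [NeZero d] (μ : Sphere d) (κ : ℝ) :
    0 < ∫ x : Sphere d, Real.exp (κ * inner ℝ (μ : EuclideanSpace ℝ (Fin d)) x) ∂(surface d) :=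
  integral_exp_pos (integrable_of_continuous _ (by fun_prop))

lemma normConst_eq_inv_integral [NeZero d] (μ : Sphere d) (κ : ℝ≥0) :
    normConst d κ =
      (∫ x : Sphere d, Real.exp (κ * inner ℝ (μ : EuclideanSpace ℝ (Fin d)) x) ∂(surface d))⁻¹ := by
  rcases eq_or_ne κ 0 with rfl | hκ
  · simp [normConst]
  · have hκ0 : (0 : ℝ) < κ := NNReal.coe_pos.2 (pos_iff_ne_zero.2 hκ)
    have hlaplace := integral_exp_inner_eq_besselI (norm_eq_of_mem_sphere μ) hκ0
    rw [finrank_euclideanSpace_fin] at hlaplace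
    rw [normConst, if_neg hκ, ← hlaplace, div_mul_cancel_left₀ (by positivity), surface]

lemma normConst_pos [NeZero d] (κ : ℝ≥0) : 0 < normConst d κ := by
  obtain ⟨μ⟩ : Nonempty (Sphere d) := inferInstance
  exact normConst_eq_inv_integral μ κ ▸ inv_pos.2 (integral_exp_inner_pos μ κ)

lemma continuous_normConst [NeZero d] : Continuous (normConst d) := by
  obtain ⟨μ⟩ : Nonempty (Sphere d) := inferInstance
  rw [funext (normConst_eq_inv_integral μ)]
  refine Continuous.inv₀ ?_ fun κ ↦ (integral_exp_inner_pos μ κ).ne'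
  simpa only [Measure.restrict_univ] using continuous_parametric_integral_of_continuous
    (μ := surface d)
    (f := fun (κ : ℝ≥0) (x : Sphere d) ↦
      Real.exp (κ * inner ℝ (μ : EuclideanSpace ℝ (Fin d)) x))
    (by simp only [Function.uncurry_def]; fun_prop) isCompact_univ

lemma continuous_uncurry_density [NeZero d] :
    Continuous (Function.uncurry (density (d := d))) := by
  have hnormConst := continuous_normConst (d := d)
  unfold density Function.uncurry
  fun_prop

lemma continuous_density [NeZero d] (θ : Component d) : Continuous (density θ) :=
  continuous_uncurry_density.uncurry_left θ

lemma density_pos [NeZero d] (θ : Component d) (x : Sphere d) : 0 < density θ x :=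
  mul_pos (normConst_pos _) (Real.exp_pos _)

lemma integral_density [NeZero d] (θ : Component d) : ∫ x, density θ x ∂(surface d) = 1 := by
  simp only [density]
  rw [integral_const_mul, normConst_eq_inv_integral θ.1,
    inv_mul_cancel₀ (integral_exp_inner_pos θ.1 _).ne']

/-- The part of a mixture carried by a set `G` of components. Such incomplete mixtures, of total
mass at most one, are the limits of mixtures whose other components vanish or concentrate at a
point. -/
noncomputable def partialMixture {ι : Type*} (G : Finset ι) (w : ι → ℝ) (θ : ι → Component d)
    (x : Sphere d) : ℝ :=
  ∑ k ∈ G, w k * density (θ k) x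

lemma continuous_partialMixture [NeZero d] {ι : Type*} (G : Finset ι) (w : ι → ℝ)
    (θ : ι → Component d) : Continuous (partialMixture G w θ) :=
  continuous_finsetSum _ fun k _ ↦ continuous_const.mul (continuous_density (θ k))

lemma partialMixture_nonneg [NeZero d] {ι : Type*} {G : Finset ι} {w : ι → ℝ}
    (hw : ∀ k ∈ G, 0 ≤ w k) (θ : ι → Component d) (x : Sphere d) : 0 ≤ partialMixture G w θ x :=
  Finset.sum_nonneg fun k hk ↦ mul_nonneg (hw k hk) (density_pos _ _).le

lemma integral_partialMixture [NeZero d] {ι : Type*} (G : Finset ι) (w : ι → ℝ)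
    (θ : ι → Component d) : ∫ x, partialMixture G w θ x ∂(surface d) = ∑ k ∈ G, w k := by
  simp only [partialMixture]
  rw [integral_finsetSum _ fun k _ ↦
    (integrable_of_continuous _ (continuous_density (θ k))).const_mul (w k)]
  simp only [integral_const_mul, integral_density, mul_one]

lemma mixDensity_eq_partialMixture (γ : Param d p) :
    mixDensity γ = partialMixture Finset.univ γ.1 γ.2 := rfl

lemma continuous_mixDensity [NeZero d] (γ : Param d p) : Continuous (mixDensity γ) :=
  continuous_partialMixture _ _ _

lemma integral_mixDensity [NeZero d] (γ : Param d p) : ∫ x, mixDensity γ x ∂(surface d) = 1 := by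
  rw [mixDensity_eq_partialMixture, integral_partialMixture]
  exact γ.1.2.2

lemma mixDensity_pos [NeZero d] (γ : Param d p) (x : Sphere d) : 0 < mixDensity γ x := by
  obtain ⟨⟨w, hw0, hw1⟩, θ⟩ := γ
  obtain ⟨k, hk, hwk⟩ := Finset.exists_ne_zero_of_sum_ne_zero (hw1 ▸ one_ne_zero)
  exact Finset.sum_pos' (fun k _ ↦ mul_nonneg (hw0 k) (density_pos _ _).le)
    ⟨k, hk, mul_pos ((hw0 k).lt_of_ne' hwk) (density_pos _ _)⟩

lemma mixDensity_le_maxDensity [NeZero d] (γ : Param d p) (x : Sphere d) :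
    mixDensity γ x ≤ maxDensity γ :=
  le_ciSup (isCompact_range (continuous_mixDensity γ)).bddAbove x

lemma maxDensity_pos [NeZero d] (γ : Param d p) : 0 < maxDensity γ := by
  obtain ⟨x⟩ : Nonempty (Sphere d) := inferInstance
  exact (mixDensity_pos γ x).trans_le (mixDensity_le_maxDensity γ x)

lemma integral_mixMeasure [NeZero d] (γ : Param d p) (φ : Sphere d → ℝ) :
    ∫ x, φ x ∂(mixMeasure γ) = ∫ x, mixDensity γ x * φ x ∂(surface d) := by
  rw [mixMeasure, integral_withDensity_eq_integral_toReal_smul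
    (continuous_mixDensity γ).measurable.ennreal_ofReal (by simp)]
  simp only [ENNReal.toReal_ofReal (mixDensity_pos γ _).le, smul_eq_mul]

lemma mixMeasure_real_le [NeZero d] (γ : Param d p) (s : Set (Sphere d)) :
    (mixMeasure γ).real s ≤ maxDensity γ * (surface d).real s := by
  have hle : mixMeasure γ ≤ ENNReal.ofReal (maxDensity γ) • surface d := by
    rw [mixMeasure, ← withDensity_const]
    exact withDensity_mono (.of_forall fun x ↦
      ENNReal.ofReal_le_ofReal (mixDensity_le_maxDensity γ x))
  refine (ENNReal.toReal_mono
    (ENNReal.mul_ne_top ENNReal.ofReal_ne_top (measure_ne_top _ _)) (hle s)).trans_eq ?_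
  rw [ENNReal.toReal_mul, ENNReal.toReal_ofReal (maxDensity_pos γ).le, measureReal_def]

lemma exists_upperRegular_mixMeasure [NeZero d] (γ : Param d p) :
    ∃ C, UpperRegular (mixMeasure γ) C (d - 1 : ℕ) := by
  refine ⟨maxDensity γ * (d * 2 ^ d *
    (volume : Measure (EuclideanSpace ℝ (Fin d))).real (Metric.ball 0 1)), fun x r hr0 hr1 ↦ ?_⟩
  have hcap := toSphere_real_closedBall_le volume x hr0 hr1
  rw [finrank_euclideanSpace_fin] at hcap
  rw [Real.rpow_natCast, mul_assoc]
  exact (mixMeasure_real_le γ _).trans (mul_le_mul_of_nonneg_left hcap (maxDensity_pos γ).le)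

end Density

section Concentration

variable {d : ℕ}

lemma exists_mul_pow_le_surface_ball [NeZero d] :
    ∃ c > 0, ∀ (x : Sphere d) (r : ℝ), 0 < r → r ≤ 1 →
      c * r ^ d ≤ (surface d).real (Metric.ball x r) := by
  refine ⟨d * (1 / 4) ^ d * (volume : Measure (EuclideanSpace ℝ (Fin d))).real (Metric.ball 0 1),
    ?_, fun x r hr0 hr1 ↦ ?_⟩
  · have hvol : 0 < (volume : Measure (EuclideanSpace ℝ (Fin d))).real (Metric.ball 0 1) :=
      ENNReal.toReal_pos (Metric.measure_ball_pos _ _ one_pos).ne' measure_ball_lt_top.ne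
    have hd : (0 : ℝ) < d := Nat.cast_pos.2 (NeZero.pos d)
    positivity
  · refine le_of_eq_of_le ?_
      (Measure.toSphereBallBound_mul_measureReal_unitBall_le_toSphere_ball volume hr0 x)
    have hmin : min r.toNNReal 2 = r.toNNReal :=
      min_eq_left (Real.toNNReal_le_iff_le_coe.2 (hr1.trans one_le_two))
    rw [Measure.toSphereBallBound, finrank_euclideanSpace_fin, if_pos ⟨NeZero.ne d, hr0⟩, hmin]
    push_cast [Real.coe_toNNReal _ hr0.le]
    ring

lemma surface_ball_mul_exp_le_integral_exp_inner (μ : Sphere d) (κ : ℝ≥0) (r : ℝ) :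
    (surface d).real (Metric.ball μ r) * Real.exp (κ * (1 - r ^ 2 / 2)) ≤
      ∫ x : Sphere d, Real.exp (κ * inner ℝ (μ : EuclideanSpace ℝ (Fin d)) x) ∂(surface d) := by
  have hint : Integrable (fun x : Sphere d ↦
      Real.exp (κ * inner ℝ (μ : EuclideanSpace ℝ (Fin d)) x)) (surface d) :=
    integrable_of_continuous _ (by fun_prop)
  refine le_trans ?_ (setIntegral_le_integral (s := Metric.ball μ r) hint
    (.of_forall fun _ ↦ (Real.exp_pos _).le))
  rw [← smul_eq_mul, ← setIntegral_const]
  refine setIntegral_mono_on (integrable_const _) hint.integrableOn measurableSet_ball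
    fun x hx ↦ ?_
  rw [inner_sphere_eq_one_sub_dist_sq]
  have hdist : dist x μ ≤ r := (Metric.mem_ball.1 hx).le
  gcongr

lemma exists_density_le_mul_exp_neg_dist_sq [NeZero d] :
    ∃ C > 0, ∀ θ : Component d, 1 ≤ θ.2 → ∀ x : Sphere d,
      density θ x ≤ C * (θ.2 : ℝ) ^ d * Real.exp (-(θ.2 * dist x θ.1 ^ 2 / 2)) := by
  obtain ⟨c, hc, hball⟩ := exists_mul_pow_le_surface_ball (d := d)
  refine ⟨Real.exp (1 / 2) / c, by positivity, fun ⟨μ, κ⟩ hκ x ↦ ?_⟩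
  simp only at hκ ⊢
  have hκ1 : (1 : ℝ) ≤ κ := NNReal.one_le_coe.2 hκ
  have hκ0 : (0 : ℝ) < κ := one_pos.trans_le hκ1
  have hexponent : (κ : ℝ) - 1 / 2 ≤ κ * (1 - (1 / κ : ℝ) ^ 2 / 2) := by
    have heq : (κ : ℝ) * (1 - (1 / κ : ℝ) ^ 2 / 2) = κ - 1 / κ / 2 := by field_simp
    linarith [(div_le_one hκ0).2 hκ1]
  have hintegral : c * (1 / κ : ℝ) ^ d * Real.exp (κ - 1 / 2) ≤
      ∫ y : Sphere d, Real.exp (κ * inner ℝ (μ : EuclideanSpace ℝ (Fin d)) y) ∂(surface d) :=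
    (mul_le_mul (hball μ _ (by positivity) ((div_le_one hκ0).2 hκ1))
      (Real.exp_le_exp.2 hexponent) (Real.exp_pos _).le measureReal_nonneg).trans
      (surface_ball_mul_exp_le_integral_exp_inner μ κ _)
  calc density (μ, κ) x
      ≤ (c * (1 / κ : ℝ) ^ d * Real.exp (κ - 1 / 2))⁻¹ *
          Real.exp (κ * (1 - dist x μ ^ 2 / 2)) := by
        rw [density, normConst_eq_inv_integral μ, inner_sphere_eq_one_sub_dist_sq]
        gcongr
    _ = _ := by
        have hsplit : (κ : ℝ) * (1 - dist x μ ^ 2 / 2) =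
          (κ - 1 / 2) + 1 / 2 + -(κ * dist x μ ^ 2 / 2) := by ring
        rw [hsplit, Real.exp_add, Real.exp_add, one_div (κ : ℝ), inv_pow]
        field_simp

end Concentration

section PairSums

lemma card_filter_offDiag_shared_le (n : ℕ) (q : ℕ × ℕ) :
    ((Finset.range n).offDiag.filter fun q' ↦
      q'.1 = q.1 ∨ q'.1 = q.2 ∨ q'.2 = q.1 ∨ q'.2 = q.2).card ≤ 4 * n := by
  have hsub : ((Finset.range n).offDiag.filter fun q' ↦
      q'.1 = q.1 ∨ q'.1 = q.2 ∨ q'.2 = q.1 ∨ q'.2 = q.2) ⊆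
      ({q.1, q.2} ×ˢ Finset.range n) ∪ (Finset.range n ×ˢ {q.1, q.2}) := by
    intro q' hq'
    simp only [Finset.mem_filter, Finset.mem_offDiag] at hq'
    simp only [Finset.mem_union, Finset.mem_product, Finset.mem_insert, Finset.mem_singleton]
    tauto
  refine (Finset.card_le_card hsub).trans ((Finset.card_union_le _ _).trans ?_)
  rw [Finset.card_product, Finset.card_product, Finset.card_range]
  have htwo : ({q.1, q.2} : Finset ℕ).card ≤ 2 := Finset.card_le_two
  nlinarith

variable {Ω S : Type*} [MeasurableSpace Ω] {P : Measure Ω}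

lemma covariance_le_half_variance_add_variance [IsFiniteMeasure P] {Y Z : Ω → ℝ}
    (hY : MemLp Y 2 P) (hZ : MemLp Z 2 P) : cov[Y, Z; P] ≤ (Var[Y; P] + Var[Z; P]) / 2 := by
  have hnonneg := variance_nonneg (Y - Z) P
  rw [variance_sub hY hZ] at hnonneg
  linarith

/-- The sum of a kernel `h` over the ordered pairs of distinct indices below `n`, that is, the
`U`-statistic with kernel `h` before normalization. -/
def pairSum (h : S × S → ℝ) (x : ℕ → S) (n : ℕ) : ℝ :=
  ∑ q ∈ (Finset.range n).offDiag, h (x q.1, x q.2)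

lemma pairSum_mono {h : S × S → ℝ} (hh : 0 ≤ h) (x : ℕ → S) : Monotone (pairSum h x) :=
  fun _ _ hmn ↦ Finset.sum_le_sum_of_subset_of_nonneg
    (Finset.offDiag_mono (Finset.range_mono hmn)) fun _ _ _ ↦ hh _

variable [MeasurableSpace S] {ν : Measure S} {X : ℕ → Ω → S}

lemma measurePreserving_prodMk_of_iIndepFun [IsFiniteMeasure P] (hX : ∀ i, Measurable (X i))
    (hindep : iIndepFun X P) (hlaw : ∀ i, P.map (X i) = ν) {i j : ℕ} (hij : i ≠ j) :
    MeasurePreserving (fun ω ↦ (X i ω, X j ω)) P (ν.prod ν) := by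
  refine ⟨(hX i).prodMk (hX j), ?_⟩
  rw [(indepFun_iff_map_prod_eq_prod_map_map (hX i).aemeasurable (hX j).aemeasurable).1
    (hindep.indepFun hij), hlaw, hlaw]

variable [IsProbabilityMeasure P] {h : S × S → ℝ}

lemma integral_pairSum (hX : ∀ i, Measurable (X i)) (hindep : iIndepFun X P)
    (hlaw : ∀ i, P.map (X i) = ν) (hh : Integrable h (ν.prod ν)) (n : ℕ) :
    ∫ ω, pairSum h (fun i ↦ X i ω) n ∂P = (n * n - n : ℕ) * ∫ q, h q ∂(ν.prod ν) := by
  have hpair {q : ℕ × ℕ} (hq : q ∈ (Finset.range n).offDiag) :=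
    measurePreserving_prodMk_of_iIndepFun hX hindep hlaw (Finset.mem_offDiag.1 hq).2.2
  have hterm (q : ℕ × ℕ) (hq : q ∈ (Finset.range n).offDiag) :
      ∫ ω, h (X q.1 ω, X q.2 ω) ∂P = ∫ q, h q ∂(ν.prod ν) := by
    rw [← (hpair hq).map_eq, integral_map (hpair hq).aemeasurable
      ((hpair hq).map_eq ▸ hh.aestronglyMeasurable)]
  have hint (q : ℕ × ℕ) (hq : q ∈ (Finset.range n).offDiag) :
      Integrable (fun ω ↦ h (X q.1 ω, X q.2 ω)) P :=
    (hpair hq).integrable_comp_of_integrable hh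
  simp only [pairSum]
  rw [integral_finsetSum _ hint, Finset.sum_congr rfl hterm, Finset.sum_const,
    Finset.offDiag_card, Finset.card_range, nsmul_eq_mul]

lemma variance_pairSum_le (hX : ∀ i, Measurable (X i)) (hindep : iIndepFun X P)
    (hlaw : ∀ i, P.map (X i) = ν) (hmeas : Measurable h) (hh : MemLp h 2 (ν.prod ν)) (n : ℕ) :
    Var[fun ω ↦ pairSum h (fun i ↦ X i ω) n; P] ≤ 4 * n ^ 3 * Var[h; ν.prod ν] := by
  set Y : ℕ × ℕ → Ω → ℝ := fun q ω ↦ h (X q.1 ω, X q.2 ω)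
  set V := Var[h; ν.prod ν]
  have hV : 0 ≤ V := variance_nonneg _ _
  have hpair {q : ℕ × ℕ} (hq : q ∈ (Finset.range n).offDiag) :=
    measurePreserving_prodMk_of_iIndepFun hX hindep hlaw (Finset.mem_offDiag.1 hq).2.2
  have hmemLp (q : ℕ × ℕ) (hq : q ∈ (Finset.range n).offDiag) : MemLp (Y q) 2 P :=
    hh.comp_measurePreserving (hpair hq)
  have hvar {q : ℕ × ℕ} (hq : q ∈ (Finset.range n).offDiag) : Var[Y q; P] = V := by
    rw [← (hpair hq).map_eq] at hh
    simp only [V, ← (hpair hq).map_eq, variance_map hh.aemeasurable (hpair hq).aemeasurable]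
    rfl
  have hcov (q : ℕ × ℕ) (hq : q ∈ (Finset.range n).offDiag)
      (q' : ℕ × ℕ) (hq' : q' ∈ (Finset.range n).offDiag) :
      cov[Y q, Y q'; P] ≤
        if q'.1 = q.1 ∨ q'.1 = q.2 ∨ q'.2 = q.1 ∨ q'.2 = q.2 then V else 0 := by
    split_ifs with hshared
    · have hle := covariance_le_half_variance_add_variance (hmemLp q hq) (hmemLp q' hq')
      rw [hvar hq, hvar hq'] at hle
      linarith
    · simp only [not_or] at hshared
      obtain ⟨h11, h12, h21, h22⟩ := hshared
      exact ((hindep.indepFun_prodMk_prodMk hX _ _ _ _ (Ne.symm h11) (Ne.symm h21) (Ne.symm h12)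
        (Ne.symm h22)).comp hmeas hmeas).covariance_eq_zero (hmemLp q hq) (hmemLp q' hq') |>.le
  calc Var[fun ω ↦ pairSum h (fun i ↦ X i ω) n; P]
      = ∑ q ∈ (Finset.range n).offDiag, ∑ q' ∈ (Finset.range n).offDiag, cov[Y q, Y q'; P] :=
        variance_fun_sum' hmemLp
    _ ≤ ∑ _q ∈ (Finset.range n).offDiag, (4 * n) * V := by
        refine Finset.sum_le_sum fun q hq ↦ (Finset.sum_le_sum (hcov q hq)).trans ?_
        rw [← Finset.sum_filter, Finset.sum_const, nsmul_eq_mul]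
        exact mul_le_mul_of_nonneg_right
          (by exact_mod_cast card_filter_offDiag_shared_le n q) hV
    _ ≤ (n * n : ℕ) * ((4 * n) * V) := by
        rw [Finset.sum_const, nsmul_eq_mul, Finset.offDiag_card, Finset.card_range]
        gcongr
        exact Nat.sub_le _ _
    _ = 4 * n ^ 3 * V := by push_cast; ring

lemma measure_pairSum_deviation_le (hX : ∀ i, Measurable (X i)) (hindep : iIndepFun X P)
    (hlaw : ∀ i, P.map (X i) = ν) (hmeas : Measurable h) (hh : MemLp h 2 (ν.prod ν))
    {n : ℕ} (hn : 0 < n) :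
    P {ω | (n : ℝ) ^ 2 ≤ |pairSum h (fun i ↦ X i ω) n -
        ∫ ω', pairSum h (fun i ↦ X i ω') n ∂P|} ≤
      ENNReal.ofReal (4 * Var[h; ν.prod ν] * (1 / n)) := by
  have hn0 : (0 : ℝ) < n := Nat.cast_pos.2 hn
  have hmemLp : MemLp (fun ω ↦ pairSum h (fun i ↦ X i ω) n) 2 P :=
    memLp_finsetSum _ fun q hq ↦ hh.comp_measurePreserving
      (measurePreserving_prodMk_of_iIndepFun hX hindep hlaw (Finset.mem_offDiag.1 hq).2.2)
  refine (meas_ge_le_variance_div_sq hmemLp (pow_pos hn0 2)).trans (ENNReal.ofReal_le_ofReal ?_)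
  calc _ ≤ 4 * n ^ 3 * Var[h; ν.prod ν] / ((n : ℝ) ^ 2) ^ 2 := by
        gcongr
        exact variance_pairSum_le hX hindep hlaw hmeas hh n
    _ = _ := by field_simp

lemma ae_eventually_pairSum_two_pow_le [IsProbabilityMeasure ν] (hX : ∀ i, Measurable (X i))
    (hindep : iIndepFun X P) (hlaw : ∀ i, P.map (X i) = ν) (hmeas : Measurable h) (hnonneg : 0 ≤ h)
    (hh : MemLp h 2 (ν.prod ν)) :
    ∀ᵐ ω ∂P, ∀ᶠ k : ℕ in atTop, pairSum h (fun i ↦ X i ω) (2 ^ k) ≤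
      (∫ q, h q ∂(ν.prod ν) + 1) * ((2 : ℝ) ^ k) ^ 2 := by
  have hsummable : ∑' k : ℕ, P {ω | ((2 ^ k : ℕ) : ℝ) ^ 2 ≤ |pairSum h (fun i ↦ X i ω) (2 ^ k) -
      ∫ ω', pairSum h (fun i ↦ X i ω') (2 ^ k) ∂P|} ≠ ∞ := by
    refine ne_top_of_le_ne_top ?_ (ENNReal.tsum_le_tsum fun k ↦
      measure_pairSum_deviation_le hX hindep hlaw hmeas hh (by positivity))
    have hgeometric : Summable fun k : ℕ ↦ 4 * Var[h; ν.prod ν] * (1 / ((2 ^ k : ℕ) : ℝ)) := by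
      simpa only [Nat.cast_pow, Nat.cast_ofNat, one_div_pow] using
        summable_geometric_two.mul_left (4 * Var[h; ν.prod ν])
    exact hgeometric.tsum_ofReal_ne_top
  filter_upwards [ae_eventually_notMem hsummable] with ω hω
  filter_upwards [hω] with k hk
  have hmean : ((2 ^ k * 2 ^ k - 2 ^ k : ℕ) : ℝ) * ∫ q, h q ∂(ν.prod ν) ≤
      ((2 : ℝ) ^ k) ^ 2 * ∫ q, h q ∂(ν.prod ν) := by
    refine mul_le_mul_of_nonneg_right ?_ (integral_nonneg hnonneg)
    exact_mod_cast (Nat.sub_le _ _).trans_eq (sq _).symm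
  rw [not_le, integral_pairSum hX hindep hlaw (hh.integrable one_le_two)] at hk
  push_cast at hk
  linarith [(le_abs_self _).trans hk.le]

lemma ae_eventually_pairSum_le [IsProbabilityMeasure ν] (hX : ∀ i, Measurable (X i))
    (hindep : iIndepFun X P) (hlaw : ∀ i, P.map (X i) = ν) (hmeas : Measurable h) (hnonneg : 0 ≤ h)
    (hh : MemLp h 2 (ν.prod ν)) :
    ∀ᵐ ω ∂P, ∀ᶠ n : ℕ in atTop, pairSum h (fun i ↦ X i ω) n ≤
      4 * (∫ q, h q ∂(ν.prod ν) + 1) * n ^ 2 := by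
  filter_upwards [ae_eventually_pairSum_two_pow_le hX hindep hlaw hmeas hnonneg hh] with ω hω
  obtain ⟨k₀, hk₀⟩ := eventually_atTop.1 hω
  filter_upwards [eventually_ge_atTop (2 ^ k₀)] with n hn
  have hn0 : n ≠ 0 := (Nat.two_pow_pos k₀).trans_le hn |>.ne'
  set k := Nat.log 2 n + 1
  have hlt : n < 2 ^ k := Nat.lt_pow_succ_log_self one_lt_two n
  have hle : (2 : ℝ) ^ k ≤ 2 * n := by
    rw [pow_succ']
    exact_mod_cast Nat.mul_le_mul_left 2 (Nat.pow_log_le_self 2 hn0)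
  have hk : k₀ ≤ k := (Nat.le_log_of_pow_le one_lt_two hn).trans (Nat.le_succ _)
  have hmean : 0 ≤ ∫ q, h q ∂(ν.prod ν) := integral_nonneg hnonneg
  calc pairSum h (fun i ↦ X i ω) n ≤ pairSum h (fun i ↦ X i ω) (2 ^ k) :=
        pairSum_mono hnonneg _ hlt.le
    _ ≤ (∫ q, h q ∂(ν.prod ν) + 1) * ((2 : ℝ) ^ k) ^ 2 := hk₀ k hk
    _ ≤ (∫ q, h q ∂(ν.prod ν) + 1) * (2 * n) ^ 2 := by gcongr
    _ = _ := by ring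

end PairSums

section BallCounts

variable {S : Type*} [PseudoMetricSpace S]

lemma card_filter_dist_le_of_pairSum_le {x : ℕ → S} {n : ℕ} {s D : ℝ} (hs : 0 ≤ s) (hD : 0 ≤ D)
    (hx : ∀ i j, i ≠ j → dist (x i) (x j) ≠ 0)
    (hsum : pairSum (fun q ↦ dist q.1 q.2 ^ (-(2 * s))) x n ≤ (D * n) ^ 2)
    (y : S) {r : ℝ} (hr : 0 < r) :
    (((Finset.range n).filter fun i ↦ dist (x i) y ≤ r).card : ℝ) ≤ 1 + D * n * (2 * r) ^ s := by
  set T := (Finset.range n).filter fun i ↦ dist (x i) y ≤ r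
  have hle : (T.card * T.card - T.card : ℝ) * (2 * r) ^ (-(2 * s)) ≤ (D * n) ^ 2 := by
    refine le_trans ?_ hsum
    calc (T.card * T.card - T.card : ℝ) * (2 * r) ^ (-(2 * s))
        = ∑ _q ∈ T.offDiag, (2 * r) ^ (-(2 * s)) := by
          rw [Finset.sum_const, nsmul_eq_mul, Finset.offDiag_card,
            Nat.cast_sub (Nat.le_mul_self _), Nat.cast_mul]
      _ ≤ ∑ q ∈ T.offDiag, dist (x q.1) (x q.2) ^ (-(2 * s)) := by
          refine Finset.sum_le_sum fun q hq ↦ ?_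
          obtain ⟨h1, h2, hne⟩ := Finset.mem_offDiag.1 hq
          refine Real.rpow_le_rpow_of_nonpos (dist_nonneg.lt_of_ne' (hx _ _ hne)) ?_ (by linarith)
          linarith [dist_triangle_right (x q.1) (x q.2) y, (Finset.mem_filter.1 h1).2,
            (Finset.mem_filter.1 h2).2]
      _ ≤ _ := Finset.sum_le_sum_of_subset_of_nonneg
          (Finset.offDiag_mono (Finset.filter_subset _ _))
          fun _ _ _ ↦ Real.rpow_nonneg dist_nonneg _
  have hr2 : 0 < 2 * r := by positivity
  have hsq : (T.card * T.card - T.card : ℝ) ≤ (D * n * (2 * r) ^ s) ^ 2 := by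
    rw [mul_pow, ← Real.rpow_mul_natCast hr2.le, mul_comm s, ← div_le_iff₀ (by positivity),
      Nat.cast_ofNat, div_eq_mul_inv, ← Real.rpow_neg hr2.le]
    exact hle
  have hnonneg : 0 ≤ D * n * (2 * r) ^ s := by positivity
  nlinarith

variable [MeasurableSpace S] {ν : Measure S} {C β : ℝ}

lemma UpperRegular.const_nonneg [Nonempty S] (hν : UpperRegular ν C β) : 0 ≤ C := by
  simpa only [Real.one_rpow, mul_one] using
    measureReal_nonneg.trans (hν (Classical.arbitrary S) 1 one_pos le_rfl)

lemma UpperRegular.measure_dist_eq_zero [IsFiniteMeasure ν] (hν : UpperRegular ν C β)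
    (hβ : 0 < β) (x : S) : ν {y | dist x y = 0} = 0 := by
  have htendsto : Tendsto (fun r : ℝ ↦ C * r ^ β) (𝓝[>] 0) (𝓝 0) := by
    have hcont : ContinuousAt (fun r : ℝ ↦ C * r ^ β) 0 :=
      continuousAt_const.mul (Real.continuousAt_rpow_const _ _ (Or.inr hβ.le))
    simpa only [ContinuousAt, Real.zero_rpow hβ.ne', mul_zero] using
      hcont.tendsto.mono_left nhdsWithin_le_nhds
  refine (measureReal_eq_zero_iff).1 (le_antisymm (ge_of_tendsto htendsto ?_) measureReal_nonneg)
  filter_upwards [Ioc_mem_nhdsGT one_pos] with r hr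
  refine (measureReal_mono fun y (hy : dist x y = 0) ↦ ?_).trans (hν x r hr.1 hr.2)
  rw [Metric.mem_closedBall, dist_comm, hy]
  exact hr.1.le

lemma UpperRegular.measure_le_dist_rpow_le [IsFiniteMeasure ν] (hν : UpperRegular ν C β)
    (hβ : 0 < β) (x : S) {t : ℝ} (ht : 1 < t) :
    ν {y | t ≤ dist x y ^ (-(β / 2))} ≤ ENNReal.ofReal (C * t ^ (-2 : ℝ)) := by
  have ht0 : 0 < t := one_pos.trans ht
  have hsub : {y | t ≤ dist x y ^ (-(β / 2))} ⊆ Metric.closedBall x (t ^ (-(2 / β))) := by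
    intro y (hy : t ≤ dist x y ^ (-(β / 2)))
    rw [Metric.mem_closedBall, dist_comm]
    calc dist x y = (dist x y ^ (-(β / 2))) ^ (-(2 / β)) := by
          rw [← Real.rpow_mul dist_nonneg, neg_mul_neg, div_mul_div_comm, mul_comm β,
            div_self (by positivity), Real.rpow_one]
      _ ≤ t ^ (-(2 / β)) := Real.rpow_le_rpow_of_nonpos ht0 hy (by rw [neg_nonpos]; positivity)
  refine (measure_mono hsub).trans ?_
  rw [← ofReal_measureReal]
  refine ENNReal.ofReal_le_ofReal ((hν x _ (by positivity)
    (Real.rpow_le_one_of_one_le_of_nonpos ht.le (by rw [neg_nonpos]; positivity))).trans_eq ?_)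
  rw [← Real.rpow_mul ht0.le, neg_mul, div_mul_cancel₀ _ hβ.ne']

variable [OpensMeasurableSpace S] [SecondCountableTopology S]

lemma UpperRegular.ae_dist_ne_zero [IsFiniteMeasure ν] (hν : UpperRegular ν C β)
    (hβ : 0 < β) : ∀ᵐ q ∂(ν.prod ν), dist q.1 q.2 ≠ 0 := by
  have hmeas : MeasurableSet {q : S × S | dist q.1 q.2 = 0} :=
    measurableSet_eq_fun measurable_dist measurable_const
  simp only [ae_iff, not_not]
  exact (Measure.measure_prod_null hmeas).2 (.of_forall (hν.measure_dist_eq_zero hβ))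

lemma UpperRegular.lintegral_dist_rpow_le [IsProbabilityMeasure ν] (hν : UpperRegular ν C β)
    (hβ : 0 < β) (x : S) :
    ∫⁻ y, ENNReal.ofReal (dist x y ^ (-(β / 2))) ∂ν ≤ 1 + ENNReal.ofReal C := by
  have hC : 0 ≤ C := have : Nonempty S := ⟨x⟩; hν.const_nonneg
  have hmeas : Measurable fun y ↦ dist x y ^ (-(β / 2)) :=
    (measurable_const.dist measurable_id).pow_const _
  rw [lintegral_eq_lintegral_meas_le ν (.of_forall fun _ ↦ Real.rpow_nonneg dist_nonneg _)
    hmeas.aemeasurable, ← Set.Ioc_union_Ioi_eq_Ioi (zero_le_one' ℝ),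
    lintegral_union measurableSet_Ioi (Set.Ioc_disjoint_Ioi le_rfl)]
  refine add_le_add ?_ ?_
  · calc _ ≤ ∫⁻ _ in Set.Ioc (0 : ℝ) 1, 1 := lintegral_mono fun _ ↦ prob_le_one
      _ = 1 := by simp
  · calc _ ≤ ∫⁻ t in Set.Ioi (1 : ℝ), ENNReal.ofReal (C * t ^ (-2 : ℝ)) :=
          setLIntegral_mono_ae' measurableSet_Ioi
            (.of_forall fun t ht ↦ hν.measure_le_dist_rpow_le hβ x ht)
      _ = ENNReal.ofReal (∫ t in Set.Ioi (1 : ℝ), C * t ^ (-2 : ℝ)) := by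
          rw [ofReal_integral_eq_lintegral_ofReal
            ((integrableOn_Ioi_rpow_of_lt (by norm_num) one_pos).const_mul C)]
          filter_upwards [ae_restrict_mem measurableSet_Ioi] with t (ht : 1 < t)
          have := one_pos.trans ht
          positivity
      _ = ENNReal.ofReal C := by
          rw [integral_const_mul, integral_Ioi_rpow_of_lt (by norm_num) one_pos]
          norm_num

lemma UpperRegular.memLp_dist_rpow [IsProbabilityMeasure ν] (hν : UpperRegular ν C β)
    (hβ : 0 < β) : MemLp (fun q : S × S ↦ dist q.1 q.2 ^ (-(β / 4))) 2 (ν.prod ν) := by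
  have hmeas : Measurable fun q : S × S ↦ dist q.1 q.2 ^ (-(β / 2)) :=
    measurable_dist.pow_const _
  have hsq (q : S × S) : (dist q.1 q.2 ^ (-(β / 4))) ^ 2 = dist q.1 q.2 ^ (-(β / 2)) := by
    rw [← Real.rpow_mul_natCast dist_nonneg]
    congr 1
    push_cast
    ring
  refine (memLp_two_iff_integrable_sq (measurable_dist.pow_const _).aestronglyMeasurable).2 ?_
  simp only [hsq]
  refine ⟨hmeas.aestronglyMeasurable, ?_⟩
  rw [hasFiniteIntegral_iff_ofReal (.of_forall fun q ↦ Real.rpow_nonneg dist_nonneg _),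
    lintegral_prod _ hmeas.ennreal_ofReal.aemeasurable]
  calc _ ≤ ∫⁻ _, (1 + ENNReal.ofReal C) ∂ν := lintegral_mono (hν.lintegral_dist_rpow_le hβ)
    _ < ∞ := by
      rw [lintegral_const]
      exact ENNReal.mul_lt_top (ENNReal.add_lt_top.2 ⟨ENNReal.one_lt_top, ENNReal.ofReal_lt_top⟩)
        (measure_lt_top _ _)

variable {Ω : Type*} [MeasurableSpace Ω] {P : Measure Ω} [IsProbabilityMeasure P]
  [IsProbabilityMeasure ν] {X : ℕ → Ω → S}

lemma ae_exists_eventually_card_filter_dist_le (hX : ∀ i, Measurable (X i))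
    (hindep : iIndepFun X P) (hlaw : ∀ i, P.map (X i) = ν) (hν : UpperRegular ν C β)
    (hβ : 0 < β) :
    ∀ᵐ ω ∂P, ∃ A : ℝ, ∀ᶠ n : ℕ in atTop, ∀ y : S, ∀ r > 0,
      (((Finset.range n).filter fun i ↦ dist (X i ω) y ≤ r).card : ℝ) ≤
        1 + A * n * r ^ (β / 8) := by
  set h : S × S → ℝ := fun q ↦ dist q.1 q.2 ^ (-(β / 4))
  have hh : 0 ≤ h := fun _ ↦ Real.rpow_nonneg dist_nonneg _
  have hne : ∀ᵐ ω ∂P, ∀ i j, i ≠ j → dist (X i ω) (X j ω) ≠ 0 := by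
    simp only [ae_all_iff]
    intro i j hij
    exact (measurePreserving_prodMk_of_iIndepFun hX hindep hlaw hij).quasiMeasurePreserving.ae
      (hν.ae_dist_ne_zero hβ)
  filter_upwards [hne, ae_eventually_pairSum_le hX hindep hlaw (measurable_dist.pow_const _) hh
    (hν.memLp_dist_rpow hβ)] with ω hω hsum
  set D := √(4 * (∫ q, h q ∂(ν.prod ν) + 1))
  have hD : D ^ 2 = 4 * (∫ q, h q ∂(ν.prod ν) + 1) :=
    Real.sq_sqrt (by linarith [integral_nonneg (μ := ν.prod ν) hh])
  refine ⟨D * 2 ^ (β / 8), ?_⟩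
  filter_upwards [hsum] with n hn y r hr
  rw [← hD, ← mul_pow] at hn
  refine (card_filter_dist_le_of_pairSum_le (s := β / 8) (D := D) (by positivity)
    (Real.sqrt_nonneg _) hω ?_ y hr).trans_eq ?_
  · convert hn using 5
    ring
  · rw [Real.mul_rpow zero_le_two hr.le]
    ring

end BallCounts

section Penalty

/-- The penalty outweighs, up to `o(n)`, every fixed multiple of `log⁺ κ`: this is the form in
which C3 enters the argument. -/
def CompensatesLog (pt : ℕ → ℝ≥0 → ℝ) : Prop :=
  ∀ a ≥ 0, ∀ η > 0, ∀ᶠ n : ℕ in atTop, ∀ κ : ℝ≥0, a * Real.posLog κ + pt n κ ≤ η * n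

variable {d : ℕ} {pt : ℕ → ℝ≥0 → ℝ}

lemma CondC2.eventually_le (h : CondC2 pt) {η : ℝ} (hη : 0 < η) :
    ∀ᶠ n : ℕ in atTop, ∀ κ, pt n κ ≤ η * n := by
  obtain ⟨⟨hbdd, hsup⟩, hfixed⟩ := h
  filter_upwards [hbdd, hsup.bound hη, (hfixed 0).bound hη] with n hbdd hsup hzero κ
  simp only [Real.norm_eq_abs, Nat.abs_cast] at hsup hzero
  rcases eq_or_ne κ 0 with rfl | hκ
  · exact (le_abs_self _).trans hzero
  · exact (le_max_right 0 _).trans ((le_ciSup hbdd ⟨κ, pos_iff_ne_zero.2 hκ⟩).trans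
      ((le_abs_self _).trans hsup))

lemma constA_pos (hd : 2 ≤ d) : 0 < constA d := by
  have hd' : (2 : ℝ) ≤ d := by exact_mod_cast hd
  have hGamma : 0 < Real.Gamma (((d : ℝ) - 1) / 2) := Real.Gamma_pos_of_pos (by linarith)
  unfold constA
  positivity

lemma mul_le_mul_of_lt_one_div_pow {m : ℕ} (hm : 2 ≤ m) {a b n l L η : ℝ} (hb : 0 < b) (hn : 0 < n)
    (hη : 0 < η) (hl : 1 ≤ l) (hL : 1 ≤ L) (hlt : l / (b * n) < 1 / L ^ m)
    (hlarge : a ^ 2 * b / η ^ 2 ≤ n) : a * L ≤ η * n := by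
  have hsq : L ^ 2 ≤ b * n := by
    rw [div_lt_div_iff₀ (by positivity) (by positivity), one_mul] at hlt
    calc L ^ 2 ≤ L ^ m := pow_le_pow_right₀ hL hm
      _ ≤ l * L ^ m := le_mul_of_one_le_left (by positivity) hl
      _ ≤ b * n := hlt.le
  refine (le_abs_self _).trans (abs_le_of_sq_le_sq ?_ (by positivity))
  rw [div_le_iff₀ (by positivity)] at hlarge
  calc (a * L) ^ 2 = a ^ 2 * L ^ 2 := by ring
    _ ≤ a ^ 2 * (b * n) := by gcongr
    _ = (a ^ 2 * b) * n := by ring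
    _ ≤ (n * η ^ 2) * n := by gcongr
    _ = (η * n) ^ 2 := by ring

lemma CondC3.compensatesLog {M : ℝ} (h3 : CondC3 d M pt) (hd : 2 ≤ d) (hM : 0 < M)
    (h2 : CondC2 pt) : CompensatesLog pt := by
  intro a ha η hη
  have hlog : Tendsto (fun n : ℕ ↦ Real.log n) atTop atTop :=
    Real.tendsto_log_atTop.comp tendsto_natCast_atTop_atTop
  have hconstA := constA_pos hd
  filter_upwards [h3, h2.eventually_le (half_pos hη), hlog.eventually_ge_atTop (a + 1),
    tendsto_natCast_atTop_atTop.eventually_ge_atTop (a ^ 2 * (M * constA d) / (η / 2) ^ 2),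
    tendsto_natCast_atTop_atTop.eventually_ge_atTop (a / (η / 2)),
    eventually_gt_atTop 0] with n hpen hle hlogn hlarge hlin hn κ
  have hn0 : (0 : ℝ) < n := Nat.cast_pos.2 hn
  have hlin : a ≤ η / 2 * n := (div_le_iff₀' (half_pos hη)).1 hlin
  rcases le_or_gt (Real.posLog κ) 1 with hsmall | hbig
  · nlinarith [hle κ]
  have hκ : 1 < κ := by
    by_contra! hκ
    have hzero : Real.posLog κ = 0 :=
      (Real.posLog_eq_zero_iff _).2 (by rwa [NNReal.abs_eq, NNReal.coe_le_one])
    linarith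
  have hposLog : Real.posLog κ = Real.log κ :=
    Real.posLog_eq_log (by rw [NNReal.abs_eq, NNReal.one_le_coe]; exact hκ.le)
  rw [hposLog] at hbig ⊢
  by_cases hC3 : 1 / Real.log κ ^ (2 * d - 2) ≤ Real.log n / (M * n * constA d)
  · have hcoef : a ≤ 3 * Real.log n ^ 2 := by nlinarith
    nlinarith [hpen κ hκ hC3, mul_le_mul_of_nonneg_right hcoef (zero_le_one.trans hbig.le),
      mul_pos hη hn0]
  · rw [not_le, mul_right_comm] at hC3
    linarith [hle κ, mul_le_mul_of_lt_one_div_pow (by omega) (mul_pos hM hconstA) hn0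
      (half_pos hη) (by linarith) hbig.le hC3 hlarge]

end Penalty

section Tail

variable {d : ℕ}

lemma exists_log_one_add_density_div_le [NeZero d] {ε : ℝ} (hε : 0 < ε) :
    ∃ C : ℝ, ∀ θ : Component d, 1 ≤ θ.2 → C ≤ θ.2 → ∀ y : Sphere d,
      Real.log (1 + density θ y / ε) ≤ (d + 1) * Real.log θ.2 ∧
      ∀ r ≥ 0, r ≤ dist y θ.1 →
        Real.log (1 + density θ y / ε) ≤ C * (θ.2 ^ d * Real.exp (-(θ.2 * r ^ 2 / 2))) := by
  obtain ⟨D, hD, hdensity⟩ := exists_density_le_mul_exp_neg_dist_sq (d := d)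
  refine ⟨1 + D / ε, fun θ hone hθ y ↦ ?_⟩
  have hκ : (1 : ℝ) ≤ θ.2 := NNReal.one_le_coe.2 hone
  have hpos : 0 < density θ y / ε := div_pos (density_pos θ y) hε
  refine ⟨?_, fun r hr hry ↦ ?_⟩
  · rw [← Nat.cast_add_one, ← Real.log_pow]
    refine Real.log_le_log (by positivity) ?_
    have hle : density θ y ≤ D * θ.2 ^ d :=
      (hdensity θ hone y).trans (mul_le_of_le_one_right (by positivity)
        (Real.exp_le_one_iff.2 (neg_nonpos.2 (by positivity))))
    calc 1 + density θ y / ε ≤ θ.2 ^ d + D * θ.2 ^ d / ε := by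
          gcongr
          exact one_le_pow₀ hκ
      _ = θ.2 ^ d * (1 + D / ε) := by ring
      _ ≤ θ.2 ^ d * θ.2 := by gcongr
      _ = θ.2 ^ (d + 1) := (pow_succ _ _).symm
  · calc Real.log (1 + density θ y / ε) ≤ density θ y / ε := by
          linarith [Real.log_le_sub_one_of_pos (by positivity : 0 < 1 + density θ y / ε)]
      _ ≤ D * θ.2 ^ d * Real.exp (-(θ.2 * dist y θ.1 ^ 2 / 2)) / ε := by
          gcongr
          exact hdensity θ hone y
      _ = D / ε * (θ.2 ^ d * Real.exp (-(θ.2 * dist y θ.1 ^ 2 / 2))) := by ring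
      _ ≤ (1 + D / ε) * (θ.2 ^ d * Real.exp (-(θ.2 * r ^ 2 / 2))) := by
          gcongr
          exact (lt_one_add _).le

lemma sum_range_le_card_filter_mul_add {n : ℕ} {f : ℕ → ℝ} {q : ℕ → Prop} [DecidablePred q]
    {a b : ℝ} (hb : 0 ≤ b) (hq : ∀ i, q i → f i ≤ a) (hnot : ∀ i, ¬q i → f i ≤ b) :
    ∑ i ∈ Finset.range n, f i ≤ ((Finset.range n).filter q).card * a + n * b := by
  calc ∑ i ∈ Finset.range n, f i
      ≤ ∑ i ∈ Finset.range n, ((if q i then a else 0) + if q i then 0 else b) :=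
        Finset.sum_le_sum fun i _ ↦ by
          split_ifs with hi
          · rw [add_zero]
            exact hq i hi
          · rw [zero_add]
            exact hnot i hi
    _ ≤ ∑ i ∈ Finset.range n, ((if q i then a else 0) + b) := by
        gcongr with i
        split_ifs <;> [exact hb; exact le_rfl]
    _ = _ := by
        rw [Finset.sum_add_distrib, ← Finset.sum_filter, Finset.sum_const, Finset.sum_const,
          Finset.card_range, nsmul_eq_mul, nsmul_eq_mul]

lemma tendsto_pow_mul_exp_neg_sqrt (d : ℕ) :
    Tendsto (fun κ : ℝ ↦ κ ^ d * Real.exp (-(√κ / 2))) atTop (𝓝 0) := by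
  have hpoly := ((Real.tendsto_pow_mul_exp_neg_atTop_nhds_zero (2 * d)).comp
    (Real.tendsto_sqrt_atTop.atTop_div_const two_pos)).const_mul (2 ^ (2 * d))
  rw [mul_zero] at hpoly
  refine hpoly.congr' ?_
  filter_upwards [eventually_ge_atTop 0] with κ hκ
  rw [Function.comp_apply, div_pow, pow_mul √κ, Real.sq_sqrt hκ]
  field_simp

lemma tendsto_rpow_neg_mul_log {s : ℝ} (hs : 0 < s) :
    Tendsto (fun κ : ℝ ↦ κ ^ (-s) * Real.log κ) atTop (𝓝 0) := by
  refine (isLittleO_log_rpow_atTop hs).tendsto_div_nhds_zero.congr' ?_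
  filter_upwards [eventually_ge_atTop 0] with κ hκ
  rw [Real.rpow_neg hκ, mul_comm, div_eq_mul_inv]

lemma exists_forall_ge_tail_coefficients_le {s : ℝ} (hs : 0 < s) (A C : ℝ) {η : ℝ} (hη : 0 < η) :
    ∃ K : ℝ≥0, 1 ≤ K ∧ C ≤ K ∧ ∀ κ ≥ K,
      C * (κ ^ d * Real.exp (-(√κ / 2))) ≤ η ∧
      (d + 1) * A * ((κ : ℝ) ^ (-(s / 4)) * Real.log κ) ≤ η := by
  have hfar := (tendsto_pow_mul_exp_neg_sqrt d).const_mul C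
  have hnear := (tendsto_rpow_neg_mul_log (s := s / 4) (by positivity)).const_mul ((d + 1) * A)
  rw [mul_zero] at hfar hnear
  obtain ⟨K, hK⟩ := eventually_atTop.1
    ((hfar.eventually_le_const hη).and (hnear.eventually_le_const hη))
  refine ⟨max 1 (max C K).toNNReal, le_max_left _ _, ?_, fun κ hκ ↦ hK κ ?_⟩
  · exact (le_max_left _ _).trans (Real.toNNReal_le_iff_le_coe.1 (le_max_right _ _))
  · exact (le_max_right _ _).trans (Real.toNNReal_le_iff_le_coe.1 ((le_max_right _ _).trans hκ))

/-- Along the observations `x`, components of large concentration cannot raise the penalized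
log-likelihood by more than `o(n)`, uniformly over all such components; `ε` stands for a lower bound
of the remaining mixture. -/
def TailNegligible (pt : ℕ → ℝ≥0 → ℝ) (x : ℕ → Sphere d) : Prop :=
  ∀ ε > 0, ∀ η > 0, ∃ K : ℝ≥0, ∀ᶠ n : ℕ in atTop, ∀ θ : Component d, K ≤ θ.2 →
    ∑ i ∈ Finset.range n, Real.log (1 + density θ (x i) / ε) + pt n θ.2 ≤ η * n

lemma CompensatesLog.tailNegligible [NeZero d] {pt : ℕ → ℝ≥0 → ℝ} (hpt : CompensatesLog pt)
    {x : ℕ → Sphere d} {A s : ℝ} (hs : 0 < s)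
    (hx : ∀ᶠ n : ℕ in atTop, ∀ y : Sphere d, ∀ r > 0,
      (((Finset.range n).filter fun i ↦ dist (x i) y ≤ r).card : ℝ) ≤ 1 + A * n * r ^ s) :
    TailNegligible pt x := by
  intro ε hε η hη
  obtain ⟨C, hC⟩ := exists_log_one_add_density_div_le (d := d) hε
  have hη3 : 0 < η / 3 := by positivity
  obtain ⟨K, hK1, hKC, hK⟩ := exists_forall_ge_tail_coefficients_le (d := d) hs A C hη3
  refine ⟨K, ?_⟩
  filter_upwards [hx, hpt (d + 1) (by positivity) (η / 3) hη3] with n hcount hpen θ hθ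
  obtain ⟨hfar, hnear⟩ := hK θ.2 hθ
  have hone : 1 ≤ θ.2 := hK1.trans hθ
  have hκ : (1 : ℝ) ≤ θ.2 := NNReal.one_le_coe.2 hone
  have hκ0 : (0 : ℝ) < θ.2 := one_pos.trans_le hκ
  have hbounds := hC θ hone (hKC.trans (NNReal.coe_le_coe.2 hθ))
  -- At this radius the Gaussian factor is `exp (-√κ / 2)`, while the ball still has small mass.
  set r : ℝ := (θ.2 : ℝ) ^ (-(1 / 4) : ℝ)
  have hr : 0 < r := by positivity
  have hκr : θ.2 * r ^ 2 = √θ.2 := by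
    rw [← Real.rpow_mul_natCast hκ0.le, ← Real.rpow_one_add' hκ0.le (by norm_num),
      Real.sqrt_eq_rpow]
    norm_num
  have hrs : r ^ s = (θ.2 : ℝ) ^ (-(s / 4)) := by
    rw [← Real.rpow_mul hκ0.le]
    ring_nf
  have hlog : 0 ≤ (d + 1) * Real.log θ.2 := mul_nonneg (by positivity) (Real.log_nonneg hκ)
  have hsum := sum_range_le_card_filter_mul_add (n := n) (q := fun i ↦ dist (x i) θ.1 ≤ r) hη3.le
    (fun i _ ↦ (hbounds (x i)).1) fun i hi ↦
      (((hbounds (x i)).2 r hr.le (not_le.1 hi).le).trans (by rwa [hκr]))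
  have hball := mul_le_mul_of_nonneg_right (hcount θ.1 r hr) hlog
  have hpen := hpen θ.2
  rw [Real.posLog_eq_log (by rwa [NNReal.abs_eq])] at hpen
  rw [hrs] at hball
  nlinarith [mul_le_mul_of_nonneg_left hnear n.cast_nonneg]

end Tail

section Equidistribution

/-- The sequence `x` is equidistributed with respect to `ν`: its empirical measures converge
weakly to `ν`. -/
def Equidistributed {S : Type*} [TopologicalSpace S] [MeasurableSpace S] (x : ℕ → S)
    (ν : Measure S) : Prop :=
  ∀ φ : C(S, ℝ), Tendsto (fun n : ℕ ↦ (∑ i ∈ Finset.range n, φ (x i)) / n) atTop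
    (𝓝 (∫ y, φ y ∂ν))

lemma Equidistributed.integral_le_integral {S : Type*} [TopologicalSpace S] [MeasurableSpace S]
    {x : ℕ → S} {ν : Measure S} (hx : Equidistributed x ν) {F : Filter ℕ} [NeBot F] (hF : F ≤ atTop)
    {φ ψ : S → ℝ} (hφ : Continuous φ) (hψ : Continuous ψ)
    (h : ∀ η > 0, ∀ᶠ n in F,
      ∑ i ∈ Finset.range n, φ (x i) ≤ ∑ i ∈ Finset.range n, ψ (x i) + η * n) :
    ∫ y, φ y ∂ν ≤ ∫ y, ψ y ∂ν := by
  refine le_of_forall_pos_le_add fun η hη ↦ ?_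
  refine le_of_tendsto_of_tendsto ((hx ⟨φ, hφ⟩).mono_left hF)
    (((hx ⟨ψ, hψ⟩).mono_left hF).add_const η) ?_
  filter_upwards [h η hη, hF (eventually_gt_atTop 0)] with n hle hn
  have hn : (0 : ℝ) < n := Nat.cast_pos.2 hn
  rwa [div_le_iff₀ hn, add_mul, div_mul_cancel₀ _ hn.ne']

variable {S : Type*} [TopologicalSpace S] [CompactSpace S]

lemma lipschitzWith_mean (x : ℕ → S) (n : ℕ) :
    LipschitzWith 1 fun φ : C(S, ℝ) ↦ (∑ i ∈ Finset.range n, φ (x i)) / n := by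
  refine LipschitzWith.of_dist_le_mul fun φ ψ ↦ ?_
  rw [NNReal.coe_one, one_mul, Real.dist_eq, ← sub_div, ← Finset.sum_sub_distrib, abs_div,
    Nat.abs_cast]
  refine div_le_of_le_mul₀ n.cast_nonneg dist_nonneg ((Finset.abs_sum_le_sum_abs _ _).trans
    ((Finset.sum_le_card_nsmul _ _ (dist φ ψ) fun i _ ↦ ContinuousMap.dist_apply_le_dist _).trans
      ?_))
  rw [Finset.card_range, nsmul_eq_mul, mul_comm]

variable [MeasurableSpace S] {ν : Measure S} [IsProbabilityMeasure ν]

lemma continuous_integral_continuousMap [OpensMeasurableSpace S] :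
    Continuous fun φ : C(S, ℝ) ↦ ∫ y, φ y ∂ν := by
  refine (LipschitzWith.of_dist_le_mul (K := 1) fun φ ψ ↦ ?_).continuous
  rw [Real.dist_eq, ← integral_sub (integrable_of_continuous ν φ.continuous)
    (integrable_of_continuous ν ψ.continuous)]
  refine (norm_integral_le_of_norm_le_const (C := dist φ ψ)
    (.of_forall fun y ↦ (dist_eq_norm (φ y) (ψ y)).symm.trans_le
      (ContinuousMap.dist_apply_le_dist y))).trans_eq ?_
  rw [probReal_univ, mul_one, NNReal.coe_one, one_mul]

lemma equidistributed_of_dense [OpensMeasurableSpace S] {s : Set C(S, ℝ)} (hs : Dense s) {x : ℕ → S}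
    (h : ∀ φ ∈ s, Tendsto (fun n : ℕ ↦ (∑ i ∈ Finset.range n, φ (x i)) / n) atTop
      (𝓝 (∫ y, φ y ∂ν))) : Equidistributed x ν := by
  have hclosed := (LipschitzWith.uniformEquicontinuous _ 1
    (lipschitzWith_mean x)).equicontinuous.isClosed_setOfPred_tendsto (l := atTop)
    (continuous_integral_continuousMap (ν := ν))
  exact fun φ ↦ closure_minimal h hclosed (hs φ)

variable {Ω : Type*} [MeasurableSpace Ω] {P : Measure Ω} {X : ℕ → Ω → S}

lemma ae_tendsto_mean [BorelSpace S] (hX : ∀ i, Measurable (X i)) (hindep : iIndepFun X P)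
    (hlaw : ∀ i, P.map (X i) = ν) (φ : C(S, ℝ)) :
    ∀ᵐ ω ∂P, Tendsto (fun n : ℕ ↦ (∑ i ∈ Finset.range n, φ (X i ω)) / n) atTop
      (𝓝 (∫ y, φ y ∂ν)) := by
  have hφ : Measurable φ := φ.continuous.measurable
  have hint : Integrable φ (P.map (X 0)) := hlaw 0 ▸ integrable_of_continuous ν φ.continuous
  rw [← hlaw 0, integral_map (hX 0).aemeasurable hφ.aestronglyMeasurable]
  exact strong_law_ae_real (fun i ω ↦ φ (X i ω)) (hint.comp_measurable (hX 0))
    (fun i j hij ↦ (hindep.indepFun hij).comp hφ hφ)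
    fun i ↦ (IdentDistrib.mk (hX i).aemeasurable (hX 0).aemeasurable
      ((hlaw i).trans (hlaw 0).symm)).comp hφ

lemma ae_equidistributed [TopologicalSpace.MetrizableSpace S] [BorelSpace S]
    (hX : ∀ i, Measurable (X i)) (hindep : iIndepFun X P) (hlaw : ∀ i, P.map (X i) = ν) :
    ∀ᵐ ω ∂P, Equidistributed (fun i ↦ X i ω) ν := by
  filter_upwards [ae_all_iff.2 fun k ↦
    ae_tendsto_mean hX hindep hlaw (TopologicalSpace.denseSeq C(S, ℝ) k)] with ω hω
  exact equidistributed_of_dense (TopologicalSpace.denseRange_denseSeq C(S, ℝ))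
    (Set.forall_mem_range.2 hω)

end Equidistribution

section KullbackLeibler

lemma mul_log_sub_log_le {a c : ℝ} (ha : 0 < a) (hc : 0 < c) :
    a * (Real.log c - Real.log a) ≤ c - a - (√a - √c) ^ 2 := by
  have hlog := Real.log_le_sub_one_of_pos (by positivity : 0 < √c / √a)
  rw [Real.log_div (by positivity) (by positivity), Real.log_sqrt hc.le, Real.log_sqrt ha.le]
    at hlog
  calc a * (Real.log c - Real.log a) = 2 * a * (Real.log c / 2 - Real.log a / 2) := by ring
    _ ≤ 2 * a * (√c / √a - 1) := by gcongr
    _ = 2 * (a / √a) * √c - 2 * a := by ring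
    _ = √c ^ 2 - √a ^ 2 - (√a - √c) ^ 2 := by
        rw [Real.div_sqrt]
        linear_combination 2 * Real.sq_sqrt ha.le
    _ = _ := by rw [Real.sq_sqrt ha.le, Real.sq_sqrt hc.le]

lemma sq_sqrt_sub_sqrt_le (a : ℝ) {b ε : ℝ} (hb : 0 ≤ b) (hε : 0 ≤ ε) :
    (√a - √b) ^ 2 ≤ 2 * (√a - √(ε + b)) ^ 2 + 2 * ε := by
  have hmono : √b ≤ √(ε + b) := Real.sqrt_le_sqrt (le_add_of_nonneg_left hε)
  nlinarith [sq_nonneg (√a - √(ε + b) - (√(ε + b) - √b)), Real.sq_sqrt hb,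
    Real.sq_sqrt (add_nonneg hε hb), Real.sqrt_nonneg b]

variable {S : Type*} [TopologicalSpace S] [CompactSpace S] [MeasurableSpace S]
  [OpensMeasurableSpace S] {ν : Measure S} [IsFiniteMeasure ν] {f g : S → ℝ}

lemma integral_sq_sqrt_sub_sqrt_le (hf : Continuous f) (hg : Continuous g) (hf0 : ∀ x, 0 < f x)
    (hg0 : ∀ x, 0 < g x)
    (h : ∫ x, f x * Real.log (f x) ∂ν ≤ ∫ x, f x * Real.log (g x) ∂ν) :
    ∫ x, (√(f x) - √(g x)) ^ 2 ∂ν ≤ ∫ x, g x ∂ν - ∫ x, f x ∂ν := by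
  have hint {φ : S → ℝ} (hφ : Continuous φ) : Integrable φ ν := integrable_of_continuous ν hφ
  have hlogf : Continuous fun x ↦ Real.log (f x) := hf.log fun x ↦ (hf0 x).ne'
  have hlogg : Continuous fun x ↦ Real.log (g x) := hg.log fun x ↦ (hg0 x).ne'
  have hcross : Integrable (fun x ↦ f x * Real.log (g x)) ν := hint (hf.mul hlogg)
  have hself : Integrable (fun x ↦ f x * Real.log (f x)) ν := hint (hf.mul hlogf)
  have hsq : Integrable (fun x ↦ (√(f x) - √(g x)) ^ 2) ν := hint ((hf.sqrt.sub hg.sqrt).pow 2)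
  have hle := integral_mono (hcross.sub hself) (((hint hg).sub (hint hf)).sub hsq)
    fun x ↦ (mul_sub _ _ _).symm.trans_le (mul_log_sub_log_le (hf0 x) (hg0 x))
  rw [integral_sub' hcross hself, integral_sub' ((hint hg).sub (hint hf)) hsq,
    integral_sub' (hint hg) (hint hf)] at hle
  linarith

-- The shift by `ε` keeps the logarithm under control where `g` vanishes.
lemma ae_eq_of_integral_mul_log_le (hf : Continuous f) (hg : Continuous g)
    (hf0 : ∀ x, 0 < f x) (hg0 : ∀ x, 0 ≤ g x) (hfg : ∫ x, g x ∂ν ≤ ∫ x, f x ∂ν)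
    (h : ∀ ε > 0, ∫ x, f x * Real.log (f x) ∂ν ≤ ∫ x, f x * Real.log (ε + g x) ∂ν) :
    f =ᵐ[ν] g := by
  have hint {φ : S → ℝ} (hφ : Continuous φ) : Integrable φ ν := integrable_of_continuous ν hφ
  have hbound (ε : ℝ) (hε : 0 < ε) :
      ∫ x, (√(f x) - √(g x)) ^ 2 ∂ν ≤ 4 * ν.real Set.univ * ε := by
    have hshift := integral_sq_sqrt_sub_sqrt_le hf (g := fun x ↦ ε + g x) (by fun_prop) hf0
      (fun x ↦ add_pos_of_pos_of_nonneg hε (hg0 x)) (h ε hε)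
    rw [integral_add (integrable_const _) (hint hg), integral_const, smul_eq_mul] at hshift
    calc ∫ x, (√(f x) - √(g x)) ^ 2 ∂ν
        ≤ ∫ x, (2 * (√(f x) - √(ε + g x)) ^ 2 + 2 * ε) ∂ν :=
          integral_mono (hint (by fun_prop)) (hint (by fun_prop))
            fun x ↦ sq_sqrt_sub_sqrt_le (f x) (hg0 x) hε.le
      _ = 2 * ∫ x, (√(f x) - √(ε + g x)) ^ 2 ∂ν + ν.real Set.univ * (2 * ε) := by
          rw [integral_add (hint (by fun_prop)) (integrable_const _), integral_const_mul,
            integral_const, smul_eq_mul]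
      _ ≤ _ := by linarith
  have htendsto : Tendsto (fun ε : ℝ ↦ 4 * ν.real Set.univ * ε) (𝓝[>] 0) (𝓝 0) := by
    simpa only [mul_zero] using
      ((continuous_const_mul (4 * ν.real Set.univ)).tendsto 0).mono_left nhdsWithin_le_nhds
  have hzero : ∫ x, (√(f x) - √(g x)) ^ 2 ∂ν = 0 :=
    le_antisymm (ge_of_tendsto htendsto (eventually_mem_nhdsWithin.mono hbound))
      (integral_nonneg fun _ ↦ sq_nonneg _)
  rw [integral_eq_zero_iff_of_nonneg (fun _ ↦ sq_nonneg _)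
    (hint (φ := fun x ↦ (√(f x) - √(g x)) ^ 2) ((hf.sqrt.sub hg.sqrt).pow 2))] at hzero
  filter_upwards [hzero] with x hx
  exact (Real.sqrt_inj (hf0 x).le (hg0 x)).1 (sub_eq_zero.1 (pow_eq_zero_iff two_ne_zero |>.1 hx))

end KullbackLeibler

section Likelihood

lemma log_add_le {a t ε : ℝ} (hε : 0 < ε) (ha : ε ≤ a) (ht : 0 ≤ t) :
    Real.log (a + t) ≤ Real.log a + Real.log (1 + t / ε) := by
  have ha0 : 0 < a := hε.trans_le ha
  rw [← Real.log_mul ha0.ne' (by positivity)]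
  refine Real.log_le_log (by positivity) ?_
  calc a + t ≤ a + a * (t / a) := by rw [mul_div_cancel₀ _ ha0.ne']
    _ ≤ a + a * (t / ε) := by gcongr
    _ = a * (1 + t / ε) := by ring

lemma log_add_sum_le {ι : Type*} (s : Finset ι) {t : ι → ℝ} (ht : ∀ i, 0 ≤ t i) {a ε : ℝ}
    (hε : 0 < ε) (ha : ε ≤ a) :
    Real.log (a + ∑ i ∈ s, t i) ≤ Real.log a + ∑ i ∈ s, Real.log (1 + t i / ε) := by
  induction s using Finset.cons_induction with
  | empty => simp
  | cons i s hi ih =>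
    have hsum : ε ≤ a + ∑ i ∈ s, t i := le_add_of_le_of_nonneg ha (Finset.sum_nonneg fun i _ ↦ ht i)
    rw [Finset.sum_cons, Finset.sum_cons, add_comm (t i), ← add_assoc]
    linarith [log_add_le hε hsum (ht i)]

lemma log_le_log_add_abs_sub_div {a b ε : ℝ} (hε : 0 < ε) (ha : ε ≤ a) (hb : 0 < b) :
    Real.log b ≤ Real.log a + |b - a| / ε := by
  have ha0 : 0 < a := hε.trans_le ha
  rw [← sub_le_iff_le_add', ← Real.log_div hb.ne' ha0.ne']
  calc Real.log (b / a) ≤ b / a - 1 := Real.log_le_sub_one_of_pos (by positivity)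
    _ = (b - a) / a := by rw [sub_div, div_self ha0.ne']
    _ ≤ |b - a| / a := by gcongr; exact le_abs_self _
    _ ≤ |b - a| / ε := by gcongr

variable {d p : ℕ} {pen : ℕ → (Fin p → ℝ≥0) → ℝ} {pt : ℕ → ℝ≥0 → ℝ}

lemma eventually_logLik_sub_le_penLogLik (hC1 : CondC1 pen pt) (γ : Param d p)
    (hfixed : ∀ l, (fun n : ℕ ↦ pt n (γ.2 l).2) =o[atTop] fun n : ℕ ↦ (n : ℝ)) (x : ℕ → Sphere d)
    {η : ℝ} (hη : 0 < η) : ∀ᶠ n : ℕ in atTop, logLik x n γ - p * (η * n) ≤ penLogLik pen x n γ := by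
  filter_upwards [eventually_all.2 fun l ↦ (hfixed l).bound hη] with n hn
  simp only [Real.norm_eq_abs, Nat.abs_cast] at hn
  have hsum := Finset.sum_le_sum fun l (_ : l ∈ Finset.univ) ↦ (abs_le.1 (hn l)).1
  rw [Fin.sum_const, nsmul_eq_mul] at hsum
  rw [penLogLik, hC1]
  linarith

variable [NeZero d]

lemma mixDensity_le_partialMixture_add (γ : Param d p) (G : Finset (Fin p)) (y : Sphere d) :
    mixDensity γ y ≤ partialMixture G γ.1 γ.2 y + ∑ l ∈ Gᶜ, density (γ.2 l) y := by
  rw [mixDensity, ← Finset.sum_add_sum_compl G, partialMixture]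
  gcongr with l
  exact mul_le_of_le_one_left (density_pos _ _).le (mem_Icc_of_mem_stdSimplex γ.1.2 l).2

lemma log_mixDensity_le (γ : Param d p) (G : Finset (Fin p)) {b ε : ℝ} (hε : 0 < ε) (hb : 0 ≤ b)
    (y : Sphere d) :
    Real.log (mixDensity γ y) ≤ Real.log (ε + b) + |partialMixture G γ.1 γ.2 y - b| / ε +
      ∑ l ∈ Gᶜ, Real.log (1 + density (γ.2 l) y / ε) := by
  have hpartial : 0 ≤ partialMixture G γ.1 γ.2 y := partialMixture_nonneg (fun k _ ↦ γ.1.2.1 k) _ _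
  have hclose := log_le_log_add_abs_sub_div hε (le_add_of_nonneg_right hb)
    (add_pos_of_pos_of_nonneg hε hpartial)
  rw [add_sub_add_left_eq_sub] at hclose
  calc Real.log (mixDensity γ y)
      ≤ Real.log (ε + partialMixture G γ.1 γ.2 y + ∑ l ∈ Gᶜ, density (γ.2 l) y) :=
        Real.log_le_log (mixDensity_pos γ y) ((mixDensity_le_partialMixture_add γ G y).trans
          (by gcongr; exact le_add_of_nonneg_left hε.le))
    _ ≤ Real.log (ε + partialMixture G γ.1 γ.2 y) +
          ∑ l ∈ Gᶜ, Real.log (1 + density (γ.2 l) y / ε) :=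
        log_add_sum_le _ (fun l ↦ (density_pos _ _).le) hε (le_add_of_nonneg_right hpartial)
    _ ≤ _ := by gcongr

lemma logLik_le (x : ℕ → Sphere d) {γ : Param d p} {G : Finset (Fin p)} {g : Sphere d → ℝ}
    {ε η : ℝ} (hε : 0 < ε) (hg : ∀ y, 0 ≤ g y)
    (hclose : ∀ y, |partialMixture G γ.1 γ.2 y - g y| ≤ ε * η) (n : ℕ) :
    logLik x n γ ≤ ∑ i ∈ Finset.range n, Real.log (ε + g (x i)) + η * n +
      ∑ l ∈ Gᶜ, ∑ i ∈ Finset.range n, Real.log (1 + density (γ.2 l) (x i) / ε) := by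
  calc logLik x n γ
      ≤ ∑ i ∈ Finset.range n, (Real.log (ε + g (x i)) + η +
          ∑ l ∈ Gᶜ, Real.log (1 + density (γ.2 l) (x i) / ε)) := by
        refine Finset.sum_le_sum fun i _ ↦ (log_mixDensity_le γ G hε (hg (x i)) (x i)).trans ?_
        gcongr
        exact (div_le_iff₀' hε).2 (hclose _)
    _ = _ := by
        rw [Finset.sum_add_distrib, Finset.sum_add_distrib, Finset.sum_const, Finset.card_range,
          nsmul_eq_mul, mul_comm η, Finset.sum_comm (s := Finset.range n)]

lemma penLogLik_le (hC1 : CondC1 pen pt) {x : ℕ → Sphere d} {n : ℕ} {γ : Param d p}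
    {G : Finset (Fin p)} {g : Sphere d → ℝ} {ε η : ℝ} (hε : 0 < ε) (hg : ∀ y, 0 ≤ g y)
    (hclose : ∀ y, |partialMixture G γ.1 γ.2 y - g y| ≤ ε * η)
    (hpen : ∀ l ∈ G, pt n (γ.2 l).2 ≤ η * n)
    (htail : ∀ l ∈ Gᶜ, ∑ i ∈ Finset.range n, Real.log (1 + density (γ.2 l) (x i) / ε) +
      pt n (γ.2 l).2 ≤ η * n) :
    penLogLik pen x n γ ≤ ∑ i ∈ Finset.range n, Real.log (ε + g (x i)) + (1 + p) * (η * n) := by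
  have hlik := logLik_le x hε hg hclose n
  have hcard := (Finset.sum_add_sum_compl G fun _ ↦ η * n).trans (Fin.sum_const p (η * n))
  rw [nsmul_eq_mul] at hcard
  have htails := Finset.sum_le_sum htail
  rw [Finset.sum_add_distrib] at htails
  rw [penLogLik, hC1, ← Finset.sum_add_sum_compl G]
  linarith [Finset.sum_le_sum hpen]

end Likelihood

section PartialLimits

lemma tendsto_atTop_or_exists_tendsto_nhds {ι α : Type*} [LinearOrder α] [OrderBot α]
    [TopologicalSpace α] [CompactIccSpace α] (𝒰 : Ultrafilter ι) (κ : ι → α) :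
    Tendsto κ 𝒰 atTop ∨ ∃ a, Tendsto κ 𝒰 (𝓝 a) := by
  refine or_iff_not_imp_left.2 fun h ↦ ?_
  rw [tendsto_atTop, not_forall] at h
  obtain ⟨K, hK⟩ := h
  have hbdd : ∀ᶠ i in 𝒰, κ i ∈ Set.Icc ⊥ K :=
    (Ultrafilter.eventually_not.2 hK).mono fun i hi ↦ ⟨bot_le, (not_le.1 hi).le⟩
  obtain ⟨a, -, ha⟩ := isCompact_Icc.ultrafilter_le_nhds' (𝒰.map κ) hbdd
  exact ⟨a, ha⟩

variable {ι : Type*} {d p : ℕ}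

/-- Convergence of a family of parameters in the compactified sense of Wald: the weights converge,
the components in `G` converge, and the concentrations of the other components tend to infinity.
The values of `θ` outside `G` are irrelevant. -/
structure PartialLimit (F : Filter ι) (γ : ι → Param d p) (G : Finset (Fin p))
    (w : stdSimplex ℝ (Fin p)) (θ : Fin p → Component d) : Prop where
  tendsto_weights : Tendsto (fun i ↦ (γ i).1) F (𝓝 w)
  tendsto_component : ∀ l ∈ G, Tendsto (fun i ↦ (γ i).2 l) F (𝓝 (θ l))
  tendsto_concentration : ∀ l ∈ Gᶜ, Tendsto (fun i ↦ ((γ i).2 l).2) F atTop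

lemma exists_partialLimit [NeZero d] (𝒰 : Ultrafilter ι) (γ : ι → Param d p) :
    ∃ G w θ, PartialLimit 𝒰 γ G w θ := by
  classical
  have hcomponent (l : Fin p) : ∃ θ : Component d,
      ¬Tendsto (fun i ↦ ((γ i).2 l).2) 𝒰 atTop → Tendsto (fun i ↦ (γ i).2 l) 𝒰 (𝓝 θ) := by
    rcases tendsto_atTop_or_exists_tendsto_nhds 𝒰 fun i ↦ ((γ i).2 l).2 with htop | ⟨κ, hκ⟩
    · exact ⟨Classical.arbitrary _, fun h ↦ absurd htop h⟩
    · exact ⟨(_, κ), fun _ ↦ Tendsto.prodMk_nhds (𝒰.map fun i ↦ ((γ i).2 l).1).le_nhds_lim hκ⟩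
  choose θ hθ using hcomponent
  refine ⟨Finset.univ.filter fun l ↦ ¬Tendsto (fun i ↦ ((γ i).2 l).2) 𝒰 atTop, _, θ,
    (𝒰.map fun i ↦ (γ i).1).le_nhds_lim, fun l hl ↦ hθ l (Finset.mem_filter.1 hl).2, fun l hl ↦ ?_⟩
  simpa using hl

variable {F : Filter ι} {γ : ι → Param d p} {G : Finset (Fin p)} {w : stdSimplex ℝ (Fin p)}
  {θ : Fin p → Component d}

lemma PartialLimit.tendstoUniformly [NeZero d] (h : PartialLimit F γ G w θ) :
    TendstoUniformly (fun i ↦ partialMixture G (γ i).1 (γ i).2) (partialMixture G w θ) F := by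
  let D : C(Component d, C(Sphere d, ℝ)) := ContinuousMap.curry ⟨_, continuous_uncurry_density⟩
  have hweight (l : Fin p) :
      Tendsto (fun i ↦ ((γ i).1 : Fin p → ℝ) l) F (𝓝 ((w : Fin p → ℝ) l)) :=
    (((continuous_apply l).comp continuous_subtype_val).tendsto w).comp h.tendsto_weights
  have hD : Tendsto (fun i ↦ ∑ l ∈ G, ((γ i).1 : Fin p → ℝ) l • D ((γ i).2 l)) F
      (𝓝 (∑ l ∈ G, (w : Fin p → ℝ) l • D (θ l))) :=
    tendsto_finsetSum _ fun l hl ↦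
      (hweight l).smul ((D.continuous.tendsto _).comp (h.tendsto_component l hl))
  have hcoe (v : Fin p → ℝ) (τ : Fin p → Component d) :
      ⇑(∑ l ∈ G, v l • D (τ l)) = partialMixture G v τ := by
    ext y
    simp [D, partialMixture]
  simpa only [hcoe] using ContinuousMap.tendsto_iff_tendstoUniformly.1 hD

lemma PartialLimit.tendsto (h : PartialLimit F γ Finset.univ w θ) : Tendsto γ F (𝓝 (w, θ)) :=
  h.tendsto_weights.prodMk_nhds
    (tendsto_pi_nhds.2 fun l ↦ h.tendsto_component l (Finset.mem_univ l))

end PartialLimits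

section Consistency

variable {d p : ℕ} [NeZero d]

lemma HasExactOrder.eq_univ_of_ae_eq_partialMixture {γ₀ : Param d p} (h : HasExactOrder γ₀)
    {G : Finset (Fin p)} {w : Fin p → ℝ} (hw : ∀ k ∈ G, 0 ≤ w k) {θ : Fin p → Component d}
    (heq : mixDensity γ₀ =ᵐ[surface d] partialMixture G w θ) : G = Finset.univ := by
  by_contra hG
  have hcard : G.card < p := by
    simpa using Finset.card_lt_card (Finset.ssubset_univ_iff.2 hG)
  have hsum : ∑ k ∈ G, w k = 1 := by
    rw [← integral_partialMixture G w θ, ← integral_congr_ae heq, integral_mixDensity]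
  let e : Fin G.card ≃ G := G.equivFin.symm
  have hreindex (f : Fin p → ℝ) : ∑ k, f (e k) = ∑ k ∈ G, f k := by
    rw [e.sum_comp fun k : G ↦ f k, Finset.sum_coe_sort]
  refine h G.card hcard
    (⟨fun k ↦ w (e k), fun k ↦ hw _ (e k).2, (hreindex w).trans hsum⟩, fun k ↦ θ (e k)) ?_
  filter_upwards [heq] with y hy
  exact hy.trans (hreindex fun k ↦ w k * density (θ k) y).symm

variable {γ₀ : Param d p} {pen : ℕ → (Fin p → ℝ≥0) → ℝ} {pt : ℕ → ℝ≥0 → ℝ} {x : ℕ → Sphere d}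
  {F : Filter ℕ} {γ : ℕ → Param d p} {G : Finset (Fin p)} {w : stdSimplex ℝ (Fin p)}
  {θ : Fin p → Component d}

lemma PartialLimit.eventually_penLogLik_le (h : PartialLimit F γ G w θ) (hF : F ≤ atTop)
    (hC1 : CondC1 pen pt) (hpt : CompensatesLog pt) (htail : TailNegligible pt x) {ε η : ℝ}
    (hε : 0 < ε) (hη : 0 < η) :
    ∀ᶠ n in F, penLogLik pen x n (γ n) ≤
      ∑ i ∈ Finset.range n, Real.log (ε + partialMixture G w θ (x i)) + (1 + p) * (η * n) := by
  have htails : ∀ᶠ n in F, ∀ l ∈ Gᶜ,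
      ∑ i ∈ Finset.range n, Real.log (1 + density ((γ n).2 l) (x i) / ε) + pt n ((γ n).2 l).2 ≤
        η * n := by
    obtain ⟨K, hK⟩ := htail ε hε η hη
    refine (Filter.eventually_all_finset Gᶜ).2 fun l hl ↦ ?_
    filter_upwards [hF hK, (h.tendsto_concentration l hl).eventually_ge_atTop K] with n hn hκ
    exact hn _ hκ
  filter_upwards [htails, hF (hpt 0 le_rfl η hη),
    Metric.tendstoUniformly_iff.1 h.tendstoUniformly (ε * η) (by positivity)]
    with n htails hpen hclose
  refine penLogLik_le hC1 hε (partialMixture_nonneg (fun k _ ↦ w.2.1 k) θ) (fun y ↦ ?_)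
    (fun l _ ↦ ?_) htails
  · rw [← Real.dist_eq, dist_comm]
    exact (hclose y).le
  · simpa using hpen ((γ n).2 l).2

lemma PartialLimit.integral_mul_log_mixDensity_le [NeBot F] (h : PartialLimit F γ G w θ)
    (hF : F ≤ atTop) (hC1 : CondC1 pen pt) (hpt : CompensatesLog pt)
    (hfixed : ∀ l, (fun n : ℕ ↦ pt n (γ₀.2 l).2) =o[atTop] fun n : ℕ ↦ (n : ℝ))
    (hx : Equidistributed x (mixMeasure γ₀)) (htail : TailNegligible pt x)
    (hmax : ∀ η > 0, ∀ᶠ n in F, penLogLik pen x n γ₀ ≤ penLogLik pen x n (γ n) + η * n)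
    {ε : ℝ} (hε : 0 < ε) :
    ∫ y, mixDensity γ₀ y * Real.log (mixDensity γ₀ y) ∂(surface d) ≤
      ∫ y, mixDensity γ₀ y * Real.log (ε + partialMixture G w θ y) ∂(surface d) := by
  have hlim (y : Sphere d) : ε + partialMixture G w θ y ≠ 0 :=
    (add_pos_of_pos_of_nonneg hε (partialMixture_nonneg (fun k _ ↦ w.2.1 k) θ y)).ne'
  rw [← integral_mixMeasure, ← integral_mixMeasure]
  refine hx.integral_le_integral hF
    ((continuous_mixDensity γ₀).log fun y ↦ (mixDensity_pos γ₀ y).ne')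
    ((continuous_const.add (continuous_partialMixture G w θ)).log hlim) fun η hη ↦ ?_
  set δ : ℝ := η / (2 * (1 + p)) with hδ
  have hδ0 : 0 < δ := by positivity
  filter_upwards [hF (eventually_logLik_sub_le_penLogLik hC1 γ₀ hfixed x hδ0), hmax δ hδ0,
    h.eventually_penLogLik_le hF hC1 hpt htail hε hδ0] with n hlower hmax hupper
  have hηδ : η * n = 2 * (1 + p) * (δ * n) := by
    rw [hδ]
    field_simp
  simp only [logLik] at hlower ⊢
  linarith

lemma PartialLimit.ae_eq_partialMixture [NeBot F] (h : PartialLimit F γ G w θ)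
    (hF : F ≤ atTop) (hC1 : CondC1 pen pt) (hpt : CompensatesLog pt)
    (hfixed : ∀ l, (fun n : ℕ ↦ pt n (γ₀.2 l).2) =o[atTop] fun n : ℕ ↦ (n : ℝ))
    (hx : Equidistributed x (mixMeasure γ₀)) (htail : TailNegligible pt x)
    (hmax : ∀ η > 0, ∀ᶠ n in F, penLogLik pen x n γ₀ ≤ penLogLik pen x n (γ n) + η * n) :
    mixDensity γ₀ =ᵐ[surface d] partialMixture G w θ := by
  refine ae_eq_of_integral_mul_log_le (continuous_mixDensity γ₀) (continuous_partialMixture G w θ)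
    (mixDensity_pos γ₀) (partialMixture_nonneg (fun k _ ↦ w.2.1 k) θ) ?_
    fun ε hε ↦ h.integral_mul_log_mixDensity_le hF hC1 hpt hfixed hx htail hmax hε
  rw [integral_partialMixture, integral_mixDensity, ← w.2.2]
  exact Finset.sum_le_sum_of_subset_of_nonneg (Finset.subset_univ _) fun l _ _ ↦ w.2.1 l

theorem tendsto_mk_of_eventually_penLogLik_le (hγ₀ : HasExactOrder γ₀) (hC1 : CondC1 pen pt)
    (hpt : CompensatesLog pt)
    (hfixed : ∀ l, (fun n : ℕ ↦ pt n (γ₀.2 l).2) =o[atTop] fun n : ℕ ↦ (n : ℝ))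
    (hx : Equidistributed x (mixMeasure γ₀)) (htail : TailNegligible pt x)
    (hmax : ∀ η > 0, ∀ᶠ n in atTop, penLogLik pen x n γ₀ ≤ penLogLik pen x n (γ n) + η * n) :
    Tendsto (fun n ↦ (⟦γ n⟧ : QuotParam d p)) atTop (𝓝 ⟦γ₀⟧) := by
  refine (tendsto_iff_ultrafilter _ _ _).2 fun 𝒰 h𝒰 ↦ ?_
  obtain ⟨G, w, θ, h⟩ := exists_partialLimit 𝒰 γ
  have heq := h.ae_eq_partialMixture h𝒰 hC1 hpt hfixed hx htail fun η hη ↦ h𝒰 (hmax η hη)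
  obtain rfl := hγ₀.eq_univ_of_ae_eq_partialMixture (fun k _ ↦ w.2.1 k) heq
  have hclass : (⟦γ₀⟧ : QuotParam d p) = ⟦(w, θ)⟧ := Quotient.sound heq
  exact hclass ▸ (continuous_quotient_mk'.tendsto _).comp h.tendsto

end Consistency

end VMF

theorem theorem2_general {d p : ℕ} (hd : 2 ≤ d)
    {Ω : Type*} [MeasurableSpace Ω] (P : Measure Ω) [IsProbabilityMeasure P]
    (γ₀ : VMF.Param d p) (hγ₀ : VMF.HasExactOrder γ₀)
    (X : ℕ → Ω → VMF.Sphere d) (hX : ∀ i, Measurable (X i)) (hindep : iIndepFun X P)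
    (hlaw : ∀ i, P.map (X i) = VMF.mixMeasure γ₀)
    (pen : ℕ → (Fin p → ℝ≥0) → ℝ) (pt : ℕ → ℝ≥0 → ℝ)
    (hC1 : VMF.CondC1 pen pt) (hpt : VMF.CompensatesLog pt)
    (hfixed : ∀ l, (fun n : ℕ ↦ pt n (γ₀.2 l).2) =o[atTop] fun n : ℕ ↦ (n : ℝ))
    (γhat : ℕ → Ω → VMF.Param d p)
    (hmax : ∀ᵐ ω ∂P, ∀ η > 0, ∀ᶠ n in atTop, VMF.penLogLik pen (fun i ↦ X i ω) n γ₀ ≤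
      VMF.penLogLik pen (fun i ↦ X i ω) n (γhat n ω) + η * n) :
    ∀ᵐ ω ∂P, Tendsto (fun n ↦ (⟦γhat n ω⟧ : VMF.QuotParam d p)) atTop (𝓝 ⟦γ₀⟧) := by
  have : NeZero d := ⟨by lia⟩
  have : IsProbabilityMeasure (VMF.mixMeasure γ₀) :=
    hlaw 0 ▸ Measure.isProbabilityMeasure_map (hX 0).aemeasurable
  have hβ : (0 : ℝ) < (d - 1 : ℕ) := Nat.cast_pos.2 (by lia)
  obtain ⟨C, hC⟩ := VMF.exists_upperRegular_mixMeasure γ₀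
  filter_upwards [hmax, VMF.ae_equidistributed hX hindep hlaw,
    VMF.ae_exists_eventually_card_filter_dist_le hX hindep hlaw hC hβ] with ω hmax hmean hcount
  obtain ⟨A, hA⟩ := hcount
  exact VMF.tendsto_mk_of_eventually_penLogLik_le hγ₀ hC1 hpt hfixed hmean
    (hpt.tailNegligible (by positivity) hA) hmax

theorem theorem2 {d p : ℕ} (hd : 2 ≤ d)
    {Ω : Type*} [MeasurableSpace Ω] (P : Measure Ω) [IsProbabilityMeasure P]
    (γ₀ : VMF.Param d p) (hγ₀ : VMF.HasExactOrder γ₀)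
    (X : ℕ → Ω → VMF.Sphere d) (hX : ∀ i, Measurable (X i)) (hindep : iIndepFun X P)
    (hlaw : ∀ i, P.map (X i) = VMF.mixMeasure γ₀)
    (pen : ℕ → (Fin p → ℝ≥0) → ℝ) (pt : ℕ → ℝ≥0 → ℝ)
    (hC1 : VMF.CondC1 pen pt) (hC2 : VMF.CondC2 pt)
    (hC3 : VMF.CondC3 d (VMF.maxDensity γ₀) pt)
    (γhat : ℕ → Ω → VMF.Param d p)
    (hmax : ∀ᵐ ω ∂P, ∀ᶠ n in atTop, ∀ γ : VMF.Param d p,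
      VMF.penLogLik pen (fun i => X i ω) n γ ≤ VMF.penLogLik pen (fun i => X i ω) n (γhat n ω)) :
    ∀ᵐ ω ∂P, Tendsto (fun n => (⟦γhat n ω⟧ : VMF.QuotParam d p)) atTop (𝓝 ⟦γ₀⟧) := by
  have : NeZero d := ⟨by lia⟩
  refine theorem2_general hd P γ₀ hγ₀ X hX hindep hlaw pen pt hC1
    (hC3.compensatesLog hd (VMF.maxDensity_pos γ₀) hC2) (fun _ ↦ hC2.2 _) γhat ?_
  filter_upwards [hmax] with ω hω η hη
  filter_upwards [hω] with n hn
  exact (hn γ₀).trans (le_add_of_nonneg_right (by positivity))
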